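/- \textbf{Setting.} For every sample size $G\in\mathbb N$ there is a population of groups, i.e. a probability distribution $P_G$ of a random group (which may change with $G$). A group $g$ consists of a size $N_g\ge 2$ with $\mathbb E(N_g)<\infty$ and, for each member $1\le i\le N_g$, a binary treatment offer $Z_{ig}$, a binary complier indicator $C_{ig}$, vectors $X_{ig},W_{ig}\in\mathbb R^k$ and scalars $Y_{ig},U_{ig}$. Take-up is $D_{ig}=C_{ig}Z_{ig}$. For a binary variable $B$ write $\bar B_{ig}=\frac1{N_g-1}\sum_{j\ne i}B_{jg}$, and let $\widehat C_{ig}=\bar D_{ig}/\bar Z_{ig}$ if $\bar Z_{ig}>0$ and $\widehat C_{ig}=0$ otherwise. Let $R=R_G$ be a function of $(c,n)\in\mathbb R\times\mathbb N$ with values in the real $k\times k$ matrices, and put $$\mathcal Z_{ig}=R(\bar C_{ig},N_g)^{-1}W_{ig},\qquad \widehat{\mathcal Z}_{ig}=R(\widehat C_{ig},N_g)^{+}W_{ig},$$ where $M^{+}$ is the Moore--Penrose inverse, and $$\widehat\vartheta=\Big(\sum_{g=1}^G\sum_{i=1}^{N_g}\widehat{\mathcal Z}_{ig}X_{ig}'\Big)^{-1}\Big(\sum_{g=1}^G\sum_{i=1}^{N_g}\widehat{\mathcal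 Z}_{ig}Y_{ig}\Big).$$ Let $\rho_g=N_g/\mathbb E(N_g)$. The expectation of an individual-level variable $h_{ig}$ is that for a member drawn uniformly from a randomly drawn group, $\mathbb E[h_{ig}]=\mathbb E\big[\frac1{N_g}\sum_{i=1}^{N_g}h_{ig}\big]$. Vectors carry the Euclidean norm and matrices the Frobenius norm. All limits, $o$ and $o_{\mathbb P}$ are for $G\to\infty$. \textbf{Theorem.} Let $\vartheta\in\mathbb R^k$ and suppose that (1) for each $G$ the groups $g=1,\dots,G$ are independent with distribution $P_G$; members of a group may be dependent, but are identically distributed: conditionally on $N_g=n$, the joint distribution of $(Z_{ig},C_{ig},X_{ig},W_{ig},Y_{ig},U_{ig},\bar C_{ig})$ is the same for all $1\le i\le n$; (2) $Y_{ig}=X_{ig}'\vartheta+U_{ig}$ almost surely; (3) $\mathbb E(\rho_g\mathcal Z_{ig}U_{ig})=0$ and $\mathbb E(\rho_g\mathcal Z_{ig}X_{ig}')=I_k$; (4) $\mathbb E[\rho_g^2\|\mathcal Z_{ig}X_{ig}'\|^2]=o(G)$; (5) $\mathbb E[\rho_g^2\|\mathcal Z_{ig}U_{ig}\|^2]=o(G)$;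 (6) $\big\|\sum_{g=1}^G\frac1{N_g}\sum_{i=1}^{N_g}\rho_g(\widehat{\mathcal Z}_{ig}-\mathcal Z_{ig})X_{ig}'\big\|=o_{\mathbb P}(G)$; (7) $\big\|\sum_{g=1}^G\frac1{N_g}\sum_{i=1}^{N_g}\rho_g(\widehat{\mathcal Z}_{ig}-\mathcal Z_{ig})U_{ig}\big\|=o_{\mathbb P}(G)$; and, in addition, that for some $k\times k$ matrix $\Sigma$ (8) $\operatorname{Var}\big(\frac1{N_g}\sum_{i=1}^{N_g}\rho_g\mathcal Z_{ig}U_{ig}\big)\to\Sigma$; (9) $\mathbb E[\rho_g^{2+\delta}\|\mathcal Z_{ig}U_{ig}\|^{2+\delta}]=o(G^{\delta/2})$ for some $\delta>0$; (10) $\big\|\sum_{g=1}^G\frac1{N_g}\sum_{i=1}^{N_g}\rho_g(\widehat{\mathcal Z}_{ig}-\mathcal Z_{ig})U_{ig}\big\|=o_{\mathbb P}(G^{1/2})$. Then $\sqrt G(\widehat\vartheta-\vartheta)$ converges in distribution to $N(0,\Sigma)$ as $G\to\infty$. (The inverse of a singular matrix is read as $0$: the inverse matrix in $\widehat\vartheta$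 exists with probability tending to one, and no assumption on the invertibility of $R(\bar C_{ig},N_g)$ is made beyond (3).) -/

import Mathlib

open MeasureTheory ProbabilityTheory Filter Topology Matrix
open scoped ENNReal BigOperators

attribute [local instance] Matrix.frobeniusNormedAddCommGroup

namespace RandSat

/-! ### The Moore-Penrose inverse of a real square matrix -/

/-- The four Penrose equations: `X` is a Moore-Penrose inverse of `M`. -/
structure IsMoorePenrose {n : Type*} [Fintype n] (M X : Matrix n n ℝ) : Prop where
  mul_mul_self : M * X * M = M
  mul_self_mul : X * M * X = X
  symm_left : (M * X)ᵀ = M * X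
  symm_right : (X * M)ᵀ = X * M

theorem IsMoorePenrose.unique {n : Type*} [Fintype n] {M X Y : Matrix n n ℝ}
    (hX : IsMoorePenrose M X) (hY : IsMoorePenrose M Y) : X = Y := by
  have h1 : M * X = M * Y := by
    calc M * X = (M * X)ᵀ := hX.symm_left.symm
      _ = ((M * Y) * (M * X))ᵀ := by rw [← Matrix.mul_assoc, hY.mul_mul_self]
      _ = (M * X)ᵀ * (M * Y)ᵀ := Matrix.transpose_mul _ _
      _ = M * X * (M * Y) := by rw [hX.symm_left, hY.symm_left]
      _ = M * Y := by rw [← Matrix.mul_assoc, hX.mul_mul_self]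
  have h2 : X * M = Y * M := by
    calc X * M = (X * M)ᵀ := hX.symm_right.symm
      _ = ((X * M) * (Y * M))ᵀ := by
          rw [Matrix.mul_assoc, ← Matrix.mul_assoc M, hY.mul_mul_self]
      _ = (Y * M)ᵀ * (X * M)ᵀ := Matrix.transpose_mul _ _
      _ = Y * M * (X * M) := by rw [hX.symm_right, hY.symm_right]
      _ = Y * M := by rw [Matrix.mul_assoc, ← Matrix.mul_assoc M, hX.mul_mul_self]
  calc X = X * M * X := hX.mul_self_mul.symm
    _ = Y * M * Y := by rw [h2, Matrix.mul_assoc, h1, ← Matrix.mul_assoc]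
    _ = Y := hY.mul_self_mul

theorem exists_isMoorePenrose {n : Type*} [Fintype n] [DecidableEq n] (M : Matrix n n ℝ) :
    ∃ X, IsMoorePenrose M X := by
  have hS : (Mᵀ * M).IsHermitian := by
    rw [Matrix.IsHermitian, Matrix.conjTranspose_eq_transpose_of_trivial, Matrix.transpose_mul,
      Matrix.transpose_transpose]
  set U : Matrix n n ℝ := (hS.eigenvectorUnitary : Matrix n n ℝ) with hU
  have hUU : Uᵀ * U = 1 := by
    have := Unitary.coe_star_mul_self hS.eigenvectorUnitary
    rwa [Matrix.star_eq_conjTranspose, Matrix.conjTranspose_eq_transpose_of_trivial] at this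
  set l := hS.eigenvalues
  have hspec : Mᵀ * M = U * Matrix.diagonal l * Uᵀ := by
    have := hS.spectral_theorem
    rw [Unitary.conjStarAlgAut_apply, Matrix.star_eq_conjTranspose,
      Matrix.conjTranspose_eq_transpose_of_trivial] at this
    simpa using this
  set T : Matrix n n ℝ := U * Matrix.diagonal (fun i => (l i)⁻¹) * Uᵀ with hT
  have key : ∀ a b : n → ℝ, (U * Matrix.diagonal a * Uᵀ) * (U * Matrix.diagonal b * Uᵀ)
      = U * Matrix.diagonal (fun i => a i * b i) * Uᵀ := by
    intro a b
    calc _ = U * (Matrix.diagonal a * (Uᵀ * U) * Matrix.diagonal b) * Uᵀ := by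
            simp only [Matrix.mul_assoc]
      _ = _ := by rw [hUU, Matrix.mul_one, Matrix.diagonal_mul_diagonal]
  have tr : ∀ a : n → ℝ, (U * Matrix.diagonal a * Uᵀ)ᵀ = U * Matrix.diagonal a * Uᵀ := by
    intro a
    simp [Matrix.transpose_mul, Matrix.mul_assoc]
  have hTS : T * (Mᵀ * M) = U * Matrix.diagonal (fun i => (l i)⁻¹ * l i) * Uᵀ := by
    rw [hspec, hT, key]
  have hTt : Tᵀ = T := tr _
  have hTST : T * (Mᵀ * M) * T = T := by
    rw [hTS, hT, key]
    congr 3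
    funext i
    by_cases h : l i = 0 <;> simp [h]
  have hSTS : (Mᵀ * M) * (T * (Mᵀ * M)) = Mᵀ * M := by
    rw [hTS, hspec, key]
    congr 3
    funext i
    by_cases h : l i = 0 <;> simp [h]
  have hTSt : (T * (Mᵀ * M))ᵀ = T * (Mᵀ * M) := by rw [hTS]; exact tr _
  refine ⟨T * Mᵀ, ?_, ?_, ?_, ?_⟩
  · have h0 : (M * (T * (Mᵀ * M)) - M)ᵀ * (M * (T * (Mᵀ * M)) - M) = 0 := by
      rw [Matrix.transpose_sub, Matrix.transpose_mul, hTSt]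
      have e1 : T * (Mᵀ * M) * Mᵀ * (M * (T * (Mᵀ * M)))
          = T * ((Mᵀ * M) * ((Mᵀ * M) * (T * (Mᵀ * M)))) := by
        simp only [Matrix.mul_assoc]
      have e2 : T * (Mᵀ * M) * Mᵀ * M = T * ((Mᵀ * M) * (Mᵀ * M)) := by
        simp only [Matrix.mul_assoc]
      have e3 : Mᵀ * (M * (T * (Mᵀ * M))) = Mᵀ * M := by
        rw [← Matrix.mul_assoc, hSTS]
      rw [Matrix.sub_mul, Matrix.mul_sub, Matrix.mul_sub, e1, e2, e3, hSTS]
      simp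
    have h1 : M * (T * (Mᵀ * M)) - M = 0 := by
      rw [← Matrix.conjTranspose_eq_transpose_of_trivial] at h0
      exact Matrix.conjTranspose_mul_self_eq_zero.1 h0
    have h2 := sub_eq_zero.1 h1
    simpa only [Matrix.mul_assoc] using h2
  · have : T * Mᵀ * M * (T * Mᵀ) = T * (Mᵀ * M) * T * Mᵀ := by simp only [Matrix.mul_assoc]
    rw [this, hTST]
  · rw [Matrix.transpose_mul, Matrix.transpose_mul, Matrix.transpose_transpose, hTt,
      Matrix.mul_assoc]
  · rw [Matrix.mul_assoc]; exact hTSt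

/-- The Moore-Penrose inverse `M⁺`, which exists and is unique. -/
noncomputable def mpinv {n : Type*} [Fintype n] [DecidableEq n] (M : Matrix n n ℝ) :
    Matrix n n ℝ :=
  Classical.choose (exists_isMoorePenrose M)

/-! ### Groups and their members -/

/-- The data of one individual: treatment offer `Z`, complier indicator `C`, regressors `X`,
the vector `W` from which the instruments are built, outcome `Y`, error term `U`. -/
structure Indiv (k : ℕ) where
  Z : Bool
  C : Bool
  X : Fin k → ℝ
  W : Fin k → ℝ
  Y : ℝ
  U : ℝ

instance (k : ℕ) : MeasurableSpace (Indiv k) :=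
  MeasurableSpace.comap (fun o : Indiv k => (o.Z, o.C, o.X, o.W, o.Y, o.U)) inferInstance

/-- Treatment take-up `D = C Z`: compliers take up the treatment exactly if it is offered to them,
never-takers (`C = 0`) do not take it up. -/
def Indiv.D {k : ℕ} (o : Indiv k) : Bool := o.C && o.Z

/-- A group: its size `N = s.1` together with the data `s.2 i` of its members `i < N`. -/
abbrev Group (k : ℕ) : Type := Σ n : ℕ, (Fin n → Indiv k)

/-- The share of the neighbours of member `i` (all other members of the group) for whom the
binary characteristic `b` is true. -/
noncomputable def nbrShare {k : ℕ} (b : Indiv k → Bool) (s : Group k) (i : Fin s.1) : ℝ :=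
  (∑ j ∈ Finset.univ.erase i, if b (s.2 j) then (1 : ℝ) else 0) / ((s.1 : ℝ) - 1)

/-- The share of offers among the neighbours. -/
noncomputable def Zbar {k : ℕ} (s : Group k) (i : Fin s.1) : ℝ := nbrShare Indiv.Z s i

/-- The take-up rate among the neighbours. -/
noncomputable def Dbar {k : ℕ} (s : Group k) (i : Fin s.1) : ℝ := nbrShare Indiv.D s i

/-- The (unobserved) share of compliers among the neighbours. -/
noncomputable def Cbar {k : ℕ} (s : Group k) (i : Fin s.1) : ℝ := nbrShare Indiv.C s i

/-- The estimated share of compliers among the neighbours. -/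
noncomputable def Chat {k : ℕ} (s : Group k) (i : Fin s.1) : ℝ :=
  if 0 < Zbar s i then Dbar s i / Zbar s i else 0

/-- The true instrument vector `R(C̄, N)⁻¹ W`. -/
noncomputable def trueInstr {k : ℕ} (R : ℝ → ℕ → Matrix (Fin k) (Fin k) ℝ) (s : Group k)
    (i : Fin s.1) : Fin k → ℝ :=
  (R (Cbar s i) s.1)⁻¹ *ᵥ (s.2 i).W

/-- The estimated instrument vector `R(Ĉ, N)⁺ W`. -/
noncomputable def estInstr {k : ℕ} (R : ℝ → ℕ → Matrix (Fin k) (Fin k) ℝ) (s : Group k)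
    (i : Fin s.1) : Fin k → ℝ :=
  mpinv (R (Chat s i) s.1) *ᵥ (s.2 i).W

/-- The estimator `ϑ̂ = (∑_g ∑_i Ẑ_ig X_ig')⁻¹ (∑_g ∑_i Ẑ_ig Y_ig)` from a sample of `G` groups. -/
noncomputable def thetaHat {k : ℕ} (R : ℝ → ℕ → Matrix (Fin k) (Fin k) ℝ) {G : ℕ}
    (sample : Fin G → Group k) : EuclideanSpace ℝ (Fin k) :=
  WithLp.toLp 2
    ((∑ g, ∑ i, vecMulVec (estInstr R (sample g) i) ((sample g).2 i).X)⁻¹ *ᵥ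
      (∑ g, ∑ i, ((sample g).2 i).Y • estInstr R (sample g) i))

/-! ### Population averages; `P` is the distribution of a group in the population -/

/-- The relative size `ρ = N / E(N)` of a group. -/
noncomputable def rho {k : ℕ} (P : Measure (Group k)) (s : Group k) : ℝ :=
  (s.1 : ℝ) / ∫ t : Group k, (t.1 : ℝ) ∂P

/-- The within-group average `(1/N) ∑_i v_i`. -/
noncomputable def groupMean {k : ℕ} {V : Type*} [AddCommGroup V] [Module ℝ V] (s : Group k)
    (v : Fin s.1 → V) : V :=
  (s.1 : ℝ)⁻¹ • ∑ i, v i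

/-- The expectation of an individual-level variable that gives equal weight to groups: draw a
group at random, then one of its members uniformly at random. -/
noncomputable def indivExp {k : ℕ} (P : Measure (Group k)) (h : ∀ s : Group k, Fin s.1 → ℝ) : ℝ :=
  ∫ s, groupMean s (h s) ∂P

/-- The same expectation for a nonnegative variable, with values in `[0, ∞]`. -/
noncomputable def indivExpNonneg {k : ℕ} (P : Measure (Group k))
    (h : ∀ s : Group k, Fin s.1 → ℝ) : ℝ≥0∞ :=
  ∫⁻ s, ENNReal.ofReal (groupMean s (h s)) ∂P

/-- The group score `(1/N) ∑_i ρ 𝒵_i U_i`. -/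
noncomputable def score {k : ℕ} (P : Measure (Group k)) (R : ℝ → ℕ → Matrix (Fin k) (Fin k) ℝ)
    (s : Group k) : Fin k → ℝ :=
  groupMean s fun i => (rho P s * (s.2 i).U) • trueInstr R s i

/-- The covariance matrix of a random vector. -/
noncomputable def covMatrix {Ω : Type*} [MeasurableSpace Ω] {k : ℕ} (P : Measure Ω)
    (V : Ω → Fin k → ℝ) : Matrix (Fin k) (Fin k) ℝ :=
  Matrix.of fun a b => cov[fun s => V s a, fun s => V s b; P]

/-- The euclidean norm of a coordinate vector. -/
noncomputable def vnorm {k : ℕ} (v : Fin k → ℝ) : ℝ := ‖(WithLp.toLp 2 v : EuclideanSpace ℝ (Fin k))‖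

/-- Observations within a group are identically distributed: given the group size, the joint
distribution of a member's own data and of the share of compliers among the member's neighbours
is the same for all members. (The measure `P.comap (Sigma.mk n)` is the restriction of `P` to the
groups of size `n`.) -/
def IdentDistribWithin {k : ℕ} (P : Measure (Group k)) : Prop :=
  ∀ (n : ℕ) (i j : Fin n),
    (P.comap (Sigma.mk n)).map (fun x : Fin n → Indiv k => (x i, Cbar (⟨n, x⟩ : Group k) i)) =
      (P.comap (Sigma.mk n)).map (fun x : Fin n → Indiv k => (x j, Cbar (⟨n, x⟩ : Group k) j))

/-- `T_G = o(r_G)` for deterministic `T_G ∈ [0, ∞]` as `G → ∞`. -/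
def IsLittle (T : ℕ → ℝ≥0∞) (r : ℕ → ℝ) : Prop :=
  Tendsto (fun G => T G / ENNReal.ofReal (r G)) atTop (𝓝 0)

/-- `T_G = o_P(r_G)` as `G → ∞`. -/
def IsLittleP {Ω : ℕ → Type*} [∀ G, MeasurableSpace (Ω G)] (μ : ∀ G, Measure (Ω G))
    (T : ∀ G, Ω G → ℝ) (r : ℕ → ℝ) : Prop :=
  ∀ ε : ℝ, 0 < ε → Tendsto (fun G => μ G {ω | ε * r G ≤ |T G ω|}) atTop (𝓝 0)

end RandSat

namespace RandSat

/-! Since `rho` is `N / E(N)`, a plain sum over members is `E(N)` times a `rho`-weighted group mean,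
and the factor `E(N)` cancels in the estimator. Write `A` for the sample average over groups of the
weighted means of `Ẑ X'`, `V` for the sum of the group scores divided by `√G`, and `e` for the sum
of the weighted means of `(Ẑ - 𝒵) U` divided by `√G`. Whenever `A` is invertible, the linear model
gives the exact identity `√G (ϑ̂ - ϑ) = A⁻¹ (V + e)` (`sqrt_smul_thetaHat_sub`).

Three limits then suffice. First, `A → 1` in probability: replacing `Ẑ` by `𝒵` costs `o_P(1)`, and
Chebyshev's weak law applies entrywise to what remains (`tendstoZeroInProb_relevance_sub_one`).
Second, `e → 0` in probability by the `√G` rate for the estimation error. Third, the characteristic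
functions of `V` converge to the Gaussian one, by Lyapunov's theorem for the projections of the
scores (`tendsto_charFun_map_score`). Dependence within a group does no harm, because only whole
groups need be independent; Jensen's inequality carries the individual moment conditions over to
group means.

To combine the limits (`tendstoInDistribution_inv_mulVec`): `V` is tight, inversion is continuous at
`1`, so `A⁻¹ (V + e) - V → 0` in probability, and Slutsky's theorem concludes. The probability space
changes with `G`, so smallness is always expressed through probabilities of exceptional events. -/

/-- In `[0, ∞]`, `∞` divided by a finite number is `∞`. The moment conditions therefore also supply,
for large `G`, the integrability of scores and instruments. -/
theorem IsLittle.eventually_lt_top {T : ℕ → ℝ≥0∞} {r : ℕ → ℝ} (h : IsLittle T r) :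
    ∀ᶠ G in atTop, T G < ∞ := by
  filter_upwards [h.eventually_lt_const zero_lt_one] with G hG
  by_contra h
  rw [not_lt, top_le_iff] at h
  rw [h, ENNReal.top_div_of_ne_top ENNReal.ofReal_ne_top] at hG
  simp at hG

/-! ### Lyapunov's theorem for row-wise i.i.d. arrays, in terms of characteristic functions -/

/-- Second order expansion of `exp (i x)` with a remainder suited to Lyapunov's condition. -/
theorem exists_norm_exp_mul_I_sub_le {ε δ : ℝ} (hε : 0 < ε) (hε1 : ε ≤ 1) (hδ : 0 < δ) :
    ∃ C : ℝ, 0 ≤ C ∧ ∀ x : ℝ, ‖Complex.exp (x * Complex.I) - (1 + x * Complex.I - x ^ 2 / 2)‖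
      ≤ ε * x ^ 2 + C * |x| ^ (2 + δ) := by
  -- For `|x| ≤ ε` the Taylor remainder is at most `|x| ^ 3 ≤ ε x ^ 2`. For `|x| ≥ ε` the crude
  -- bound `2 + |x| + x ^ 2 / 2` is at most the bracket times `x ^ 2`, and `x ^ 2 ≤ ε ^ (-δ) |x| ^
  -- (2 + δ)`. No upper bound on `δ` is needed.
  refine ⟨(2 / ε ^ 2 + 1 / ε + 1 / 2) * ε ^ (-δ), by positivity, fun x => ?_⟩
  rcases le_total |x| ε with hx | hx
  · have hxI : ‖(x : ℂ) * Complex.I‖ = |x| := by simp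
    have h := Complex.exp_bound (x := (x : ℂ) * Complex.I) (by rw [hxI]; linarith)
      (n := 3) (by norm_num)
    have hs : ∑ m ∈ Finset.range 3, ((x : ℂ) * Complex.I) ^ m / (m.factorial : ℂ)
        = 1 + x * Complex.I - x ^ 2 / 2 := by
      simp only [Finset.sum_range_succ, Finset.sum_range_zero, mul_pow, Complex.I_sq]
      norm_num [Nat.factorial]
      ring
    rw [hs, hxI] at h
    have h3 : |x| ^ 3 ≤ ε * x ^ 2 := by
      rw [← sq_abs x]; nlinarith [sq_nonneg |x|]
    have h4 : (((3 : ℕ).succ : ℝ) * (((3 : ℕ).factorial : ℝ) * (3 : ℕ))⁻¹) ≤ 1 := by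
      norm_num [Nat.factorial]
    have h5 : 0 ≤ (2 / ε ^ 2 + 1 / ε + 1 / 2) * ε ^ (-δ) * |x| ^ (2 + δ) := by positivity
    have h6 : 0 ≤ |x| ^ 3 := by positivity
    nlinarith
  · have hx0 : 0 < |x| := hε.trans_le hx
    have h1 : ‖Complex.exp (x * Complex.I) - (1 + x * Complex.I - x ^ 2 / 2)‖
        ≤ 2 + |x| + x ^ 2 / 2 := by
      have e : Complex.exp (x * Complex.I) - (1 + x * Complex.I - x ^ 2 / 2)
        = Complex.exp (x * Complex.I) - 1 - x * Complex.I + (x : ℂ) ^ 2 / 2 := by ring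
      rw [e]
      refine (norm_add_le _ _).trans ?_
      have := (norm_sub_le (Complex.exp (x * Complex.I) - 1) (x * Complex.I))
      have h2 := (norm_sub_le (Complex.exp (x * Complex.I)) 1)
      rw [Complex.norm_exp_ofReal_mul_I] at h2
      simp only [norm_mul, Complex.norm_real, Complex.norm_I, mul_one, Real.norm_eq_abs,
        norm_one, norm_div, norm_pow, sq_abs, Complex.norm_ofNat] at *
      linarith
    have h2 : 2 + |x| + x ^ 2 / 2 ≤ (2 / ε ^ 2 + 1 / ε + 1 / 2) * x ^ 2 := by
      have a1 : 1 ≤ |x| / ε := (one_le_div hε).2 hx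
      have a2 : 2 / ε ^ 2 * x ^ 2 = 2 * (|x| / ε) ^ 2 := by rw [← sq_abs x]; field_simp
      have a3 : 1 / ε * x ^ 2 = |x| * (|x| / ε) := by rw [← sq_abs x]; field_simp
      rw [add_mul, add_mul, a2, a3]
      nlinarith
    have h3 : x ^ 2 ≤ ε ^ (-δ) * |x| ^ (2 + δ) := by
      rw [Real.rpow_add hx0, Real.rpow_neg hε.le]
      have : ε ^ δ ≤ |x| ^ δ := Real.rpow_le_rpow hε.le hx hδ.le
      have h2' : |x| ^ (2 : ℝ) = x ^ 2 := by rw [← sq_abs x]; exact_mod_cast Real.rpow_natCast |x| 2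
      rw [h2']
      have hp : 0 < ε ^ δ := by positivity
      have : 1 ≤ (ε ^ δ)⁻¹ * |x| ^ δ := by
        rw [inv_mul_eq_div]; exact (one_le_div hp).2 this
      nlinarith [sq_nonneg x]
    calc _ ≤ _ := h1
      _ ≤ _ := h2
      _ ≤ (2 / ε ^ 2 + 1 / ε + 1 / 2) * (ε ^ (-δ) * |x| ^ (2 + δ)) := by gcongr
      _ ≤ _ := by nlinarith [sq_nonneg x]

/-- Integrate the pointwise expansion at `a * f x`; the linear term drops out because `f` is
centered. The scale `a` will be `1 / √G`. -/
theorem norm_charFun_sub_le {α : Type*} [MeasurableSpace α] {ν : Measure α}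
    [IsProbabilityMeasure ν] {f : α → ℝ} {ε δ C a : ℝ} (hf : MemLp f 2 ν) (hmean : ∫ x, f x ∂ν = 0)
    (ha : 0 ≤ a)
    (hint : Integrable (fun x => |f x| ^ (2 + δ)) ν)
    (hC : ∀ x : ℝ, ‖Complex.exp (x * Complex.I) - (1 + x * Complex.I - x ^ 2 / 2)‖
      ≤ ε * x ^ 2 + C * |x| ^ (2 + δ)) :
    ‖∫ x, Complex.exp ((a * f x : ℝ) * Complex.I) ∂ν - 1 + ((a ^ 2 * (∫ x, f x ^ 2 ∂ν) / 2 : ℝ) : ℂ)‖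
      ≤ ε * (a ^ 2 * ∫ x, f x ^ 2 ∂ν) + C * (a ^ (2 + δ) * ∫ x, |f x| ^ (2 + δ) ∂ν) := by
  have hsq : Integrable (fun x => f x ^ 2) ν := hf.integrable_sq
  have hf1 : Integrable f ν := hf.integrable (by norm_num)
  have hexp : Integrable (fun x => Complex.exp ((a * f x : ℝ) * Complex.I)) ν := by
    refine Integrable.of_bound (C := 1) ?_ (ae_of_all _ fun x => ?_)
    · have := hf.aestronglyMeasurable.aemeasurable
      exact (by fun_prop : AEMeasurable _ ν).aestronglyMeasurable
    · rw [Complex.norm_exp_ofReal_mul_I]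
  have hq : Integrable (fun x => (1 : ℂ) + ((a * f x : ℝ) : ℂ) * Complex.I
      - ((a * f x : ℝ) : ℂ) ^ 2 / 2) ν := by
    refine ((integrable_const _).add ((hf1.const_mul a).ofReal.mul_const _)).sub ?_
    have := ((hsq.const_mul (a ^ 2)).ofReal (𝕜 := ℂ)).div_const 2
    refine this.congr (ae_of_all _ fun x => ?_)
    simp [mul_pow]
  have hqi : ∫ x, ((1 : ℂ) + ((a * f x : ℝ) : ℂ) * Complex.I - ((a * f x : ℝ) : ℂ) ^ 2 / 2) ∂ν
      = 1 - ((a ^ 2 * (∫ x, f x ^ 2 ∂ν) / 2 : ℝ) : ℂ) := by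
    have e : ∀ x, (1 : ℂ) + ((a * f x : ℝ) : ℂ) * Complex.I - ((a * f x : ℝ) : ℂ) ^ 2 / 2
        = (1 : ℂ) + (((a * f x : ℝ) : ℂ) * Complex.I - ((a ^ 2 / 2 * f x ^ 2 : ℝ) : ℂ)) := by
      intro x; push_cast; ring
    have i1 : Integrable (fun x => ((a * f x : ℝ) : ℂ) * Complex.I) ν :=
      ((hf1.const_mul a).ofReal (𝕜 := ℂ)).mul_const _
    have i2 : Integrable (fun x => ((a ^ 2 / 2 * f x ^ 2 : ℝ) : ℂ)) ν :=
      (hsq.const_mul (a ^ 2 / 2)).ofReal (𝕜 := ℂ)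
    have e1 : ∫ x, ((a * f x : ℝ) : ℂ) * Complex.I ∂ν = 0 := by
      rw [integral_mul_const, integral_complex_ofReal, integral_const_mul, hmean]; simp
    have e2 : ∫ x, ((a ^ 2 / 2 * f x ^ 2 : ℝ) : ℂ) ∂ν
        = ((a ^ 2 / 2 * ∫ x, f x ^ 2 ∂ν : ℝ) : ℂ) := by
      rw [integral_complex_ofReal, integral_const_mul]
    simp_rw [e]
    have i3 := integral_add (integrable_const (1 : ℂ)) (i1.sub i2)
    simp only [Pi.sub_apply] at i3
    rw [i3, integral_sub i1 i2, e1, e2]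
    simp
    ring
  have key : ∫ x, Complex.exp ((a * f x : ℝ) * Complex.I) ∂ν - 1
      + ((a ^ 2 * (∫ x, f x ^ 2 ∂ν) / 2 : ℝ) : ℂ)
      = ∫ x, (Complex.exp ((a * f x : ℝ) * Complex.I) -
        ((1 : ℂ) + ((a * f x : ℝ) : ℂ) * Complex.I - ((a * f x : ℝ) : ℂ) ^ 2 / 2)) ∂ν := by
    rw [integral_sub hexp hq, hqi]; ring
  have hr : Integrable (fun x => ε * (a ^ 2 * f x ^ 2) + C * (a ^ (2 + δ) * |f x| ^ (2 + δ))) ν :=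
    ((hsq.const_mul _).const_mul _).add ((hint.const_mul _).const_mul _)
  rw [key]
  refine (norm_integral_le_integral_norm _).trans ?_
  refine (integral_mono (hexp.sub hq).norm hr fun x => ?_).trans_eq ?_
  · refine (hC (a * f x)).trans_eq ?_
    rw [abs_mul, abs_of_nonneg ha, Real.mul_rpow ha (abs_nonneg _), mul_pow]
  · rw [integral_add ((hsq.const_mul _).const_mul _) ((hint.const_mul _).const_mul _)]
    simp_rw [integral_const_mul]

/-- **Lyapunov's theorem** for arrays whose rows are i.i.d. and centered. -/
theorem tendsto_charFun_pow_of_lyapunov {α : ℕ → Type*} [∀ G, MeasurableSpace (α G)]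
    (ν : ∀ G, Measure (α G)) [∀ G, IsProbabilityMeasure (ν G)] (f : ∀ G, α G → ℝ) {v δ : ℝ}
    (hδ : 0 < δ)
    (hf : ∀ᶠ G in atTop, MemLp (f G) 2 (ν G)) (hmean : ∀ᶠ G in atTop, ∫ x, f G x ∂(ν G) = 0)
    (hvar : Tendsto (fun G => ∫ x, f G x ^ 2 ∂(ν G)) atTop (𝓝 v))
    (hlyap : IsLittle (fun G => ∫⁻ x, ENNReal.ofReal (|f G x| ^ (2 + δ)) ∂(ν G))
      (fun G => (G : ℝ) ^ (δ / 2))) :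
    Tendsto (fun G : ℕ => (∫ x, Complex.exp (((√(G : ℝ))⁻¹ * f G x : ℝ) * Complex.I) ∂(ν G)) ^ G)
      atTop (𝓝 (Complex.exp (-v / 2))) := by
  set φ : ℕ → ℂ := fun G => ∫ x, Complex.exp (((√(G : ℝ))⁻¹ * f G x : ℝ) * Complex.I) ∂(ν G)
  set L : ℕ → ℝ := fun G => (∫ x, |f G x| ^ (2 + δ) ∂(ν G)) / (G : ℝ) ^ (δ / 2)
  have hfin : ∀ᶠ G in atTop, Integrable (fun x => |f G x| ^ (2 + δ)) (ν G) := by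
    filter_upwards [hlyap.eventually_lt_top, hf] with G hG hfG
    refine ⟨(hfG.aestronglyMeasurable.aemeasurable.abs.pow_const _).aestronglyMeasurable, ?_⟩
    rw [hasFiniteIntegral_iff_ofReal (ae_of_all _ fun x => by positivity)]
    exact hG
  have hL : Tendsto L atTop (𝓝 0) := by
    have h0 := (ENNReal.tendsto_toReal ENNReal.zero_ne_top).comp hlyap
    refine Tendsto.congr' ?_ h0
    filter_upwards [hfin] with G hG
    simp only [Function.comp_apply, ENNReal.toReal_div]
    rw [ENNReal.toReal_ofReal (by positivity),
      ← integral_eq_lintegral_of_nonneg_ae (ae_of_all _ fun x => by positivity)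
        hG.aestronglyMeasurable]
  -- It suffices that `G (φ G - 1) → -v / 2`, since then `φ ^ G = (1 + (φ - 1)) ^ G → exp (-v / 2)`.
  have hmain : Tendsto (fun G : ℕ => (G : ℂ) * (φ G - 1)
      + ((∫ x, f G x ^ 2 ∂(ν G)) / 2 : ℝ)) atTop (𝓝 0) := by
    rw [tendsto_zero_iff_norm_tendsto_zero]
    rw [Metric.tendsto_nhds]
    intro η hη
    -- The second moment is eventually below `|v| + 1`, so the quadratic error uses at most `η / 2`;
    -- the other half is left for the Lyapunov term `C * L G`.
    obtain ⟨ε, hε, hε1, hεη⟩ : ∃ ε : ℝ, 0 < ε ∧ ε ≤ 1 ∧ ε * (|v| + 1) ≤ η / 2 := by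
      refine ⟨min 1 (η / 2 / (|v| + 1)), by positivity, min_le_left _ _, ?_⟩
      calc _ ≤ η / 2 / (|v| + 1) * (|v| + 1) := by gcongr; exact min_le_right _ _
        _ = η / 2 := by field_simp
    obtain ⟨C, hC0, hC⟩ := exists_norm_exp_mul_I_sub_le hε hε1 hδ
    have hv : ∀ᶠ G in atTop, ∫ x, f G x ^ 2 ∂(ν G) < |v| + 1 :=
      hvar.eventually_lt_const (by linarith [le_abs_self v])
    have hCL : ∀ᶠ G in atTop, C * L G < η / 2 := by
      have : Tendsto (fun G => C * L G) atTop (𝓝 0) := by simpa using hL.const_mul C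
      exact this.eventually_lt_const (by positivity)
    filter_upwards [hv, hCL, hf, hmean, hfin, eventually_gt_atTop 0] with G h1 h2 h3 h4 h5 h6
    have hG : (0 : ℝ) < G := by exact_mod_cast h6
    have hb := norm_charFun_sub_le (a := (√(G : ℝ))⁻¹) h3 h4 (by positivity) h5 hC
    have ha2 : ((√(G : ℝ))⁻¹) ^ 2 = (G : ℝ)⁻¹ := by rw [inv_pow, Real.sq_sqrt hG.le]
    have had : (G : ℝ) * ((√(G : ℝ))⁻¹) ^ (2 + δ) = ((G : ℝ) ^ (δ / 2))⁻¹ := by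
      rw [Real.sqrt_eq_rpow, ← Real.rpow_neg hG.le, ← Real.rpow_mul hG.le, ← Real.rpow_neg hG.le]
      nth_rewrite 1 [← Real.rpow_one (G : ℝ)]
      rw [← Real.rpow_add hG]
      congr 1; ring
    rw [dist_zero_right, norm_norm]
    have e : (G : ℂ) * (φ G - 1) + ((∫ x, f G x ^ 2 ∂(ν G)) / 2 : ℝ)
        = (G : ℂ) * (φ G - 1 + ((((√(G : ℝ))⁻¹) ^ 2 * (∫ x, f G x ^ 2 ∂(ν G)) / 2 : ℝ) : ℂ)) := by
      rw [ha2]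
      have : (G : ℂ) ≠ 0 := by exact_mod_cast h6.ne'
      push_cast
      field_simp
    rw [e, norm_mul, Complex.norm_natCast]
    calc _ ≤ (G : ℝ) * _ := mul_le_mul_of_nonneg_left hb hG.le
      _ = ε * (∫ x, f G x ^ 2 ∂(ν G)) + C * L G := by
          rw [mul_add, ha2]
          have : (G : ℝ) * (C * ((√(G : ℝ))⁻¹ ^ (2 + δ) * ∫ x, |f G x| ^ (2 + δ) ∂(ν G)))
            = C * (((G : ℝ) * ((√(G : ℝ))⁻¹) ^ (2 + δ)) * ∫ x, |f G x| ^ (2 + δ) ∂(ν G)) := by ring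
          rw [this, had]
          simp only [L]
          field_simp
      _ < η := by nlinarith
  have hg : Tendsto (fun G : ℕ => (G : ℂ) * (φ G - 1)) atTop (𝓝 (-v / 2)) := by
    have h2 : Tendsto (fun G => (((∫ x, f G x ^ 2 ∂(ν G)) / 2 : ℝ) : ℂ)) atTop
        (𝓝 ((v / 2 : ℝ) : ℂ)) :=
      (Complex.continuous_ofReal.tendsto _).comp (hvar.div_const 2)
    have := hmain.sub h2
    refine (this.congr fun G => by ring).trans_eq ?_
    congr 1; push_cast; ring
  have := Complex.tendsto_one_add_pow_exp_of_tendsto hg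
  refine this.congr fun G => ?_
  simp [φ]

/-! ### Convergence to zero in probability -/

/-- `T_G → 0` in probability, where the probability space may change with `G`. -/
def TendstoZeroInProb {Ω : ℕ → Type*} [∀ G, MeasurableSpace (Ω G)] {E : Type*} [Norm E]
    (μ : ∀ G, Measure (Ω G)) (T : ∀ G, Ω G → E) : Prop :=
  ∀ ε : ℝ, 0 < ε → Tendsto (fun G => μ G {ω | ε ≤ ‖T G ω‖}) atTop (𝓝 0)

section InProb

variable {Ω : ℕ → Type*} [∀ G, MeasurableSpace (Ω G)] {μ : ∀ G, Measure (Ω G)}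
  {E F : Type*} [NormedAddCommGroup E] [NormedAddCommGroup F]

/-- To be small in probability it is enough to be controlled by something small in probability
outside of sets of small measure. -/
theorem TendstoZeroInProb.of_control {T : ∀ G, Ω G → E} {S : ∀ G, Ω G → F}
    (hS : TendstoZeroInProb μ S)
    (h : ∀ ε : ℝ, 0 < ε → ∃ η : ℝ, 0 < η ∧ ∀ᶠ G in atTop, ∀ᵐ ω ∂(μ G), ‖S G ω‖ < η → ‖T G ω‖ < ε) :
    TendstoZeroInProb μ T := by
  intro ε hε
  obtain ⟨η, hη, hle⟩ := h ε hε
  refine tendsto_of_tendsto_of_tendsto_of_le_of_le' tendsto_const_nhds (hS η hη)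
    (Eventually.of_forall fun _ => zero_le) ?_
  filter_upwards [hle] with G hG
  refine measure_mono_ae ?_
  filter_upwards [hG] with ω hω
  intro (h1 : ε ≤ _)
  by_contra h2
  exact absurd (hω (not_le.1 h2)) (not_lt.2 h1)

theorem TendstoZeroInProb.of_norm_le {T : ∀ G, Ω G → E} {S : ∀ G, Ω G → F}
    (hS : TendstoZeroInProb μ S) (h : ∀ᶠ G in atTop, ∀ᵐ ω ∂(μ G), ‖T G ω‖ ≤ ‖S G ω‖) :
    TendstoZeroInProb μ T :=
  hS.of_control fun ε hε => ⟨ε, hε, h.mono fun _ hG => hG.mono fun _ h1 h2 => h1.trans_lt h2⟩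

theorem TendstoZeroInProb.add {T T' : ∀ G, Ω G → E}
    (hT : TendstoZeroInProb μ T) (hT' : TendstoZeroInProb μ T') :
    TendstoZeroInProb μ (fun G ω => T G ω + T' G ω) := by
  intro ε hε
  have := (hT (ε / 2) (by positivity)).add (hT' (ε / 2) (by positivity))
  rw [add_zero] at this
  refine tendsto_of_tendsto_of_tendsto_of_le_of_le tendsto_const_nhds this
    (fun _ => zero_le) fun G => ?_
  refine (measure_mono ?_).trans (measure_union_le _ _)
  intro ω (h : ε ≤ _)
  by_contra h2
  simp only [Set.mem_union, Set.mem_ofPred_eq, not_or, not_le] at h2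
  linarith [norm_add_le (T G ω) (T' G ω)]

theorem TendstoZeroInProb.sum {ι : Type*} (s : Finset ι) {T : ι → ∀ G, Ω G → E}
    (hT : ∀ i, TendstoZeroInProb μ (T i)) :
    TendstoZeroInProb μ (fun G ω => ∑ i ∈ s, T i G ω) := by
  classical
  induction s using Finset.induction_on with
  | empty =>
    intro ε hε
    simp [not_le.2 hε]
  | insert a s ha ih =>
    simp_rw [Finset.sum_insert ha]
    exact (hT a).add ih

/-- The product carries the maximum norm, so a single `η` will control both `A - 1` and `e`. -/
theorem TendstoZeroInProb.prodMk {T : ∀ G, Ω G → E} {S : ∀ G, Ω G → F}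
    (hT : TendstoZeroInProb μ T) (hS : TendstoZeroInProb μ S) :
    TendstoZeroInProb μ (fun G ω => (T G ω, S G ω)) := by
  have h1 : TendstoZeroInProb μ (fun G ω => ((T G ω, 0) : E × F)) :=
    hT.of_norm_le (Eventually.of_forall fun G => ae_of_all _ fun ω => by simp)
  have h2 : TendstoZeroInProb μ (fun G ω => ((0, S G ω) : E × F)) :=
    hS.of_norm_le (Eventually.of_forall fun G => ae_of_all _ fun ω => by simp)
  simpa using h1.add h2

/-- `o_P(r_G)` divided by `r_G` tends to zero in probability. -/
theorem IsLittleP.tendstoZeroInProb {T : ∀ G, Ω G → ℝ} {r : ℕ → ℝ} (hr : ∀ᶠ G in atTop, 0 < r G)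
    (hT : IsLittleP μ T r) : TendstoZeroInProb μ (fun G ω => (r G)⁻¹ * T G ω) := by
  intro ε hε
  refine (hT ε hε).congr' ?_
  filter_upwards [hr] with G hG
  congr 1
  ext ω
  simp only [Set.mem_ofPred_eq, norm_mul, norm_inv, Real.norm_eq_abs, abs_of_pos hG]
  rw [inv_mul_eq_div, le_div_iff₀ hG]

end InProb

/-- **Chebyshev's weak law** for arrays whose rows are i.i.d. -/
theorem tendstoZeroInProb_mean_sub {Ω α : ℕ → Type*} [∀ G, MeasurableSpace (Ω G)]
    [∀ G, MeasurableSpace (α G)] {μ : ∀ G, Measure (Ω G)} [∀ G, IsProbabilityMeasure (μ G)]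
    {P : ∀ G, Measure (α G)} {S : ∀ G : ℕ, Fin G → Ω G → α G} (h_law : ∀ G g, HasLaw (S G g) (P G) (μ G))
    (h_indep : ∀ G, iIndepFun (S G) (μ G)) {f : ∀ G, α G → ℝ} (hf : ∀ G, Measurable (f G))
    {m : ℝ} (hmean : ∀ G, ∫ x, f G x ∂(P G) = m)
    (hsq : IsLittle (fun G => ∫⁻ x, ENNReal.ofReal (f G x ^ 2) ∂(P G)) (fun G => (G : ℝ))) :
    TendstoZeroInProb μ (fun G ω => (G : ℝ)⁻¹ * ∑ g, f G (S G g ω) - m) := by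
  intro ε hε
  -- Chebyshev bounds the probability by variance over `ε ^ 2`, hence by `E f ^ 2 / G / ε ^ 2`.
  have hlim : Tendsto (fun G : ℕ => (∫⁻ x, ENNReal.ofReal (f G x ^ 2) ∂(P G)) / ENNReal.ofReal (G : ℝ)
      / ENNReal.ofReal (ε ^ 2)) atTop (𝓝 0) := by
    have := ENNReal.Tendsto.div_const hsq (b := ENNReal.ofReal (ε ^ 2)) (Or.inr (by positivity))
    simpa using this
  refine tendsto_of_tendsto_of_tendsto_of_le_of_le' tendsto_const_nhds hlim
    (Eventually.of_forall fun _ => zero_le) ?_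
  filter_upwards [hsq.eventually_lt_top, eventually_gt_atTop 0] with G hG hG0
  have hGr : (0 : ℝ) < G := by exact_mod_cast hG0
  have : IsProbabilityMeasure (P G) := (h_law G ⟨0, hG0⟩).isProbabilityMeasure_iff.1 inferInstance
  have hint : Integrable (fun x => f G x ^ 2) (P G) := by
    refine ⟨((hf G).pow_const 2).aestronglyMeasurable, ?_⟩
    rw [hasFiniteIntegral_iff_ofReal (ae_of_all _ fun x => by positivity)]
    exact hG
  have hL2 : MemLp (f G) 2 (P G) := (memLp_two_iff_integrable_sq (hf G).aestronglyMeasurable).2 hint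
  have hS2 : ∀ g, MemLp (fun ω => f G (S G g ω)) 2 (μ G) := fun g => by
    have h := h_law G g
    rw [← h.map_eq] at hL2
    exact hL2.comp_of_map h.aemeasurable
  have hvar : ∀ g, Var[fun ω => f G (S G g ω); μ G] ≤ ∫ x, f G x ^ 2 ∂(P G) := fun g => by
    have h1 : Var[fun ω => f G (S G g ω); μ G] = Var[f G; P G] := by
      rw [← (h_law G g).map_eq, variance_map (hf G).aemeasurable (h_law G g).aemeasurable]
      rfl
    rw [h1]
    exact variance_le_expectation_sq (hf G).aestronglyMeasurable
  have hX2 : MemLp (fun ω => (G : ℝ)⁻¹ * ∑ g, f G (S G g ω)) 2 (μ G) :=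
    (memLp_finsetSum _ fun g _ => hS2 g).const_mul _
  have hEX : ∫ ω, (G : ℝ)⁻¹ * ∑ g, f G (S G g ω) ∂(μ G) = m := by
    rw [integral_const_mul, integral_finsetSum _ fun g _ => (hS2 g).integrable (by norm_num)]
    have : ∀ g, ∫ ω, f G (S G g ω) ∂(μ G) = m := fun g => by
      rw [← hmean G]
      exact (h_law G g).integral_comp (hf G).aestronglyMeasurable
    simp [this, hGr.ne']
  have hVX : Var[fun ω => (G : ℝ)⁻¹ * ∑ g, f G (S G g ω); μ G]
      ≤ (∫ x, f G x ^ 2 ∂(P G)) / G := by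
    rw [variance_const_mul]
    have hs : Var[fun ω => ∑ g, f G (S G g ω); μ G] = ∑ g, Var[fun ω => f G (S G g ω); μ G] := by
      have := IndepFun.variance_sum (s := Finset.univ) (X := fun g ω => f G (S G g ω))
        (fun g _ => hS2 g) (fun i _ j _ hij => ((h_indep G).indepFun hij).comp (hf G) (hf G))
      rw [← this]
      congr 1
      ext ω
      simp
    rw [hs]
    calc _ ≤ ((G : ℝ)⁻¹) ^ 2 * ∑ g : Fin G, ∫ x, f G x ^ 2 ∂(P G) := by
          gcongr with g; exact hvar g
      _ = _ := by simp; field_simp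
  have hch := meas_ge_le_variance_div_sq hX2 hε
  rw [hEX] at hch
  refine hch.trans ?_
  calc _ ≤ ENNReal.ofReal ((∫ x, f G x ^ 2 ∂(P G)) / G / ε ^ 2) := by gcongr
    _ = _ := by
      rw [ENNReal.ofReal_div_of_pos (by positivity), ENNReal.ofReal_div_of_pos hGr,
        ofReal_integral_eq_lintegral_ofReal hint (ae_of_all _ fun x => by positivity)]

end RandSat

namespace RandSat

/-! ### Slutsky's theorem on varying probability spaces -/

section Slutsky

variable {Ω : ℕ → Type*} [∀ G, MeasurableSpace (Ω G)] {μ : ∀ G, Measure (Ω G)}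
  [∀ G, IsProbabilityMeasure (μ G)]
  {E : Type*} [NormedAddCommGroup E] [InnerProductSpace ℝ E] [FiniteDimensional ℝ E]
  [MeasurableSpace E] [BorelSpace E]

theorem norm_exp_mul_I_sub_exp_le (a b : ℝ) :
    ‖Complex.exp (a * Complex.I) - Complex.exp (b * Complex.I)‖ ≤ |a - b| := by
  have e : Complex.exp (a * Complex.I) - Complex.exp (b * Complex.I)
      = Complex.exp (b * Complex.I) * (Complex.exp (Complex.I * ((a - b : ℝ) : ℂ)) - 1) := by
    rw [mul_sub, mul_one, ← Complex.exp_add]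
    congr 2; push_cast; ring
  rw [e, norm_mul, Complex.norm_exp_ofReal_mul_I, one_mul]
  exact Real.norm_exp_I_mul_ofReal_sub_one_le

/-- Where `‖Y - X‖ < η` the two exponentials differ by at most `‖t‖ * η`, as `exp (i x)` is
1-Lipschitz; elsewhere they differ by at most 2. -/
theorem norm_charFun_map_sub_le {α : Type*} [MeasurableSpace α] {ν : Measure α}
    [IsProbabilityMeasure ν] {X Y : α → E} (hX : AEMeasurable X ν) (hY : AEMeasurable Y ν) (t : E)
    {η : ℝ} (hη : 0 ≤ η) :
    ‖charFun (ν.map Y) t - charFun (ν.map X) t‖ ≤ ‖t‖ * η + 2 * ν.real {ω | η ≤ ‖Y ω - X ω‖} := by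
  have hi : ∀ {V : α → E}, AEMeasurable V ν →
      Integrable (fun ω => Complex.exp ((inner ℝ (V ω) t : ℝ) * Complex.I)) ν := fun {V} hV => by
    refine Integrable.of_bound (C := 1) ?_ (ae_of_all _ fun x => ?_)
    · exact (by fun_prop : AEMeasurable _ ν).aestronglyMeasurable
    · rw [Complex.norm_exp_ofReal_mul_I]
  have hs : NullMeasurableSet {ω | η ≤ ‖Y ω - X ω‖} ν :=
    nullMeasurableSet_le aemeasurable_const (hY.sub hX).norm
  rw [charFun_apply, charFun_apply, integral_map hX (by fun_prop), integral_map hY (by fun_prop),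
    ← integral_sub (hi hY) (hi hX)]
  refine (norm_integral_le_integral_norm _).trans ?_
  have hI : Integrable (fun ω => ‖t‖ * η + {ω | η ≤ ‖Y ω - X ω‖}.indicator (fun _ => (2 : ℝ)) ω) ν :=
    (integrable_const _).add ((integrable_const _).indicator₀ hs)
  refine (integral_mono ((hi hY).sub (hi hX)).norm hI fun ω => ?_).trans_eq ?_
  · by_cases h : η ≤ ‖Y ω - X ω‖
    · have h2 := norm_sub_le (Complex.exp ((inner ℝ (Y ω) t : ℝ) * Complex.I))
        (Complex.exp ((inner ℝ (X ω) t : ℝ) * Complex.I))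
      rw [Complex.norm_exp_ofReal_mul_I, Complex.norm_exp_ofReal_mul_I] at h2
      have h3 : ω ∈ {ω | η ≤ ‖Y ω - X ω‖} := h
      rw [Set.indicator_of_mem h3]
      have : 0 ≤ ‖t‖ * η := by positivity
      rw [Pi.sub_apply]
      linarith
    · have h3 : ω ∉ {ω | η ≤ ‖Y ω - X ω‖} := h
      rw [Set.indicator_of_notMem h3, add_zero]
      refine (norm_exp_mul_I_sub_exp_le _ _).trans ?_
      rw [← inner_sub_left, mul_comm]
      refine (abs_real_inner_le_norm _ _).trans ?_
      gcongr
      exact (not_le.1 h).le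
  · rw [integral_add (integrable_const _) ((integrable_const _).indicator₀ hs),
      integral_indicator₀ hs]
    simp [mul_comm]

/-- **Slutsky's theorem**: if the characteristic functions of `X_G` converge to that of `ν` and
`Y_G - X_G` tends to zero in probability, then `Y_G` converges in distribution to `ν`. -/
theorem tendstoInDistribution_of_charFun_of_sub {X Y : ∀ G, Ω G → E}
    {ν : Measure E} [IsProbabilityMeasure ν]
    (hX : ∀ G, AEMeasurable (X G) (μ G)) (hY : ∀ G, AEMeasurable (Y G) (μ G))
    (hchar : ∀ t, Tendsto (fun G => charFun ((μ G).map (X G)) t) atTop (𝓝 (charFun ν t)))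
    (hXY : TendstoZeroInProb μ (fun G ω => Y G ω - X G ω)) :
    TendstoInDistribution Y atTop (id : E → E) μ ν where
  forall_aemeasurable := hY
  aemeasurable_limit := aemeasurable_id
  tendsto := by
    refine ProbabilityMeasure.tendsto_iff_tendsto_charFun.2 fun t => ?_
    simp only [ProbabilityMeasure.coe_mk, Measure.map_id]
    refine (hchar t).congr_dist ?_
    rw [Metric.tendsto_nhds]
    intro ε hε
    -- The Lipschitz part then contributes at most `ε / 2`, and an exceptional probability below `ε
    -- / 4` contributes less than `ε / 2`. The `+ 1` covers `t = 0`.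
    have hη : 0 < ε / 2 / (‖t‖ + 1) := by positivity
    have h1 := (ENNReal.tendsto_toReal ENNReal.zero_ne_top).comp (hXY _ hη)
    have h2 : ∀ᶠ G in atTop, (μ G).real {ω | ε / 2 / (‖t‖ + 1) ≤ ‖Y G ω - X G ω‖} < ε / 4 :=
      h1.eventually_lt_const (by simp; positivity)
    filter_upwards [h2] with G hG
    rw [dist_zero_right, Real.norm_of_nonneg dist_nonneg, dist_comm, dist_eq_norm]
    refine (norm_charFun_map_sub_le (hX G) (hY G) t hη.le).trans_lt ?_
    have : ‖t‖ * (ε / 2 / (‖t‖ + 1)) ≤ ε / 2 := by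
      rw [mul_div_assoc', div_le_iff₀ (by positivity)]
      nlinarith [norm_nonneg t]
    linarith

/-- Random vectors whose characteristic functions converge are bounded in probability, hence do
not affect smallness in probability. -/
theorem TendstoZeroInProb.of_control_of_charFun {F F' : Type*} [NormedAddCommGroup F]
    [NormedAddCommGroup F'] {X : ∀ G, Ω G → E} {T : ∀ G, Ω G → F} {S : ∀ G, Ω G → F'}
    {ν : Measure E} [IsProbabilityMeasure ν] (hX : ∀ G, AEMeasurable (X G) (μ G))
    (hchar : ∀ t, Tendsto (fun G => charFun ((μ G).map (X G)) t) atTop (𝓝 (charFun ν t)))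
    (hS : TendstoZeroInProb μ S)
    (h : ∀ ε M : ℝ, 0 < ε → ∃ η : ℝ, 0 < η ∧
      ∀ᶠ G in atTop, ∀ᵐ ω ∂(μ G), ‖S G ω‖ < η → ‖X G ω‖ ≤ M → ‖T G ω‖ < ε) :
    TendstoZeroInProb μ T := by
  intro ε hε
  have hp : ∀ G, IsProbabilityMeasure ((μ G).map (X G)) :=
    fun G => Measure.isProbabilityMeasure_map (hX G)
  -- Pointwise convergence of characteristic functions to a continuous limit gives tightness. So `M`
  -- can be chosen from `q` alone, uniformly in `G`, and only afterwards `η` from `ε` and `M`.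
  have htight := tendsto_measure_norm_gt_of_isTightMeasureSet
    (isTightMeasureSet_of_tendsto_charFun (μ := fun G => (μ G).map (X G))
      (f := charFun ν) (by fun_prop) hchar)
  rw [ENNReal.tendsto_nhds_zero] at htight ⊢
  intro q hq
  obtain ⟨M, hM⟩ := (htight (q / 2) (ENNReal.half_pos hq.ne')).exists
  have hM' : ∀ G, μ G {ω | M < ‖X G ω‖} ≤ q / 2 := fun G => by
    refine le_trans ?_ hM
    refine le_trans ?_ (le_iSup₂ (f := fun ν (_ : ν ∈ Set.range fun G => (μ G).map (X G)) =>
      ν {x | M < ‖x‖}) _ ⟨G, rfl⟩)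
    rw [Measure.map_apply_of_aemeasurable (hX G)
      (measurableSet_lt measurable_const measurable_norm)]
    rfl
  obtain ⟨η, hη, hle⟩ := h ε M hε
  have hSq := ENNReal.tendsto_nhds_zero.1 (hS η hη) (q / 2) (ENNReal.half_pos hq.ne')
  filter_upwards [hle, hSq] with G h1 h2
  calc μ G {ω | ε ≤ ‖T G ω‖} ≤ μ G ({ω | η ≤ ‖S G ω‖} ∪ {ω | M < ‖X G ω‖}) := by
        refine measure_mono_ae ?_
        filter_upwards [h1] with ω hω
        intro (h3 : ε ≤ _)
        by_contra h4
        have h5 : ¬ (η ≤ ‖S G ω‖ ∨ M < ‖X G ω‖) := h4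
        push Not at h5
        exact absurd (hω h5.1 h5.2) (not_lt.2 h3)
    _ ≤ q / 2 + q / 2 := (measure_union_le _ _).trans (add_le_add h2 (hM' G))
    _ = q := ENNReal.add_halves q

end Slutsky

/-! ### The inverse of a matrix close to the identity -/

/-- Write `A⁻¹ (v + e) - v = (A⁻¹ - 1) (v + e) + e`; determinant and inverse are continuous at `1`,
so the bound is uniform over `‖v‖ ≤ M`. -/
theorem exists_isUnit_det_norm_inv_mulVec_sub_lt {n : Type*} [Fintype n] [DecidableEq n]
    {ε M : ℝ} (hε : 0 < ε) :
    ∃ η : ℝ, 0 < η ∧ ∀ (A : Matrix n n ℝ) (v e : EuclideanSpace ℝ n), ‖A - 1‖ < η → ‖e‖ < η →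
      ‖v‖ ≤ M → IsUnit A.det ∧ ‖WithLp.toLp 2 (A⁻¹ *ᵥ (v + e).ofLp) - v‖ < ε := by
  let Φ : Matrix n n ℝ → EuclideanSpace ℝ n →L[ℝ] EuclideanSpace ℝ n :=
    fun A => Matrix.toEuclideanCLM (n := n) (𝕜 := ℝ) A
  have hΦ : Continuous Φ :=
    LinearMap.continuous_of_finiteDimensional
      (Matrix.toEuclideanCLM (n := n) (𝕜 := ℝ)).toAlgEquiv.toLinearMap
  have hinv : ContinuousAt (fun A : Matrix n n ℝ => A⁻¹) 1 := by
    refine continuousAt_matrix_inv _ ?_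
    rw [Matrix.det_one, Ring.inverse_eq_inv']
    exact continuousAt_inv₀ one_ne_zero
  have hdet : ∀ᶠ A : Matrix n n ℝ in 𝓝 1, A.det ≠ 0 := by
    have : Continuous fun A : Matrix n n ℝ => A.det := continuous_id.matrix_det
    refine this.continuousAt.eventually_ne ?_
    simp
  -- `|M| + 1` bounds `‖v + e‖` once `‖e‖ < 1`; the absolute value is there because `M` is not
  -- assumed nonnegative.
  have hε' : 0 < ε / 2 / (|M| + 1) := by positivity
  have hN : ∀ᶠ A : Matrix n n ℝ in 𝓝 1, ‖Φ A⁻¹ - 1‖ < ε / 2 / (|M| + 1) := by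
    have h1 : ContinuousAt (fun A : Matrix n n ℝ => ‖Φ A⁻¹ - 1‖) 1 :=
      ((hΦ.continuousAt.comp hinv).sub continuousAt_const).norm
    refine h1.eventually_lt continuousAt_const ?_
    simpa [Φ] using hε'
  obtain ⟨η, hη, hball⟩ := Metric.eventually_nhds_iff.1 (hdet.and hN)
  refine ⟨min η (min 1 (ε / 2)), by positivity, fun A v e hA he hv => ?_⟩
  obtain ⟨h1, h2⟩ := hball (y := A) (by
    rw [dist_eq_norm]; exact hA.trans_le (min_le_left _ _))
  refine ⟨isUnit_iff_ne_zero.2 h1, ?_⟩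
  have he1 : ‖e‖ < 1 := he.trans_le ((min_le_right _ _).trans (min_le_left _ _))
  have he2 : ‖e‖ < ε / 2 := he.trans_le ((min_le_right _ _).trans (min_le_right _ _))
  have key : WithLp.toLp 2 (A⁻¹ *ᵥ (v + e).ofLp) - v = (Φ A⁻¹ - 1) (v + e) + e := by
    have : WithLp.toLp 2 (A⁻¹ *ᵥ (v + e).ofLp) = Φ A⁻¹ (v + e) := rfl
    rw [this]
    simp
    abel
  rw [key]
  calc _ ≤ ‖Φ A⁻¹ - 1‖ * ‖v + e‖ + ‖e‖ :=
        (norm_add_le _ _).trans (by gcongr; exact ContinuousLinearMap.le_opNorm _ _)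
    _ ≤ ε / 2 / (|M| + 1) * (|M| + 1) + ‖e‖ := by
        gcongr
        exact (norm_add_le _ _).trans (add_le_add (hv.trans (le_abs_self _)) he1.le)
    _ = ε / 2 + ‖e‖ := by field_simp
    _ < ε := by linarith

end RandSat

namespace RandSat

variable {k : ℕ}

/-! ### Measurability -/

/-- A set of groups is measurable exactly if its part in each group size is, so measurability can be
checked with the size fixed. -/
theorem measurable_group {β : Type*} [MeasurableSpace β] {f : Group k → β}
    (h : ∀ n, Measurable fun x : Fin n → Indiv k => f ⟨n, x⟩) : Measurable f := by
  intro t ht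
  exact MeasurableSpace.measurableSet_iInf.2 fun n => h n ht

theorem measurable_indiv_tuple :
    Measurable fun o : Indiv k => (o.Z, o.C, o.X, o.W, o.Y, o.U) :=
  comap_measurable _

theorem measurable_offer_complier {n : ℕ} :
    Measurable fun (x : Fin n → Indiv k) (j : Fin n) => ((x j).Z, (x j).C) := by
  refine measurable_pi_lambda _ fun j => ?_
  have := (measurable_indiv_tuple (k := k)).comp (measurable_pi_apply (X := fun _ : Fin n => Indiv k) j)
  exact this.fst.prodMk this.snd.fst

theorem measurable_X {n : ℕ} (i : Fin n) (a : Fin k) :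
    Measurable fun x : Fin n → Indiv k => (x i).X a := by
  have := (measurable_indiv_tuple (k := k)).comp (measurable_pi_apply (X := fun _ : Fin n => Indiv k) i)
  exact (measurable_pi_apply a).comp this.snd.snd.fst

theorem measurable_W {n : ℕ} (i : Fin n) (a : Fin k) :
    Measurable fun x : Fin n → Indiv k => (x i).W a := by
  have := (measurable_indiv_tuple (k := k)).comp (measurable_pi_apply (X := fun _ : Fin n => Indiv k) i)
  exact (measurable_pi_apply a).comp this.snd.snd.snd.fst

theorem measurable_Y {n : ℕ} (i : Fin n) : Measurable fun x : Fin n → Indiv k => (x i).Y := by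
  have := (measurable_indiv_tuple (k := k)).comp (measurable_pi_apply (X := fun _ : Fin n => Indiv k) i)
  exact this.snd.snd.snd.snd.fst

theorem measurable_U {n : ℕ} (i : Fin n) : Measurable fun x : Fin n → Indiv k => (x i).U := by
  have := (measurable_indiv_tuple (k := k)).comp (measurable_pi_apply (X := fun _ : Fin n => Indiv k) i)
  exact this.snd.snd.snd.snd.snd

/-- `R` is arbitrary, without any measurability. For fixed `n`, however, `Cbar` and `Chat` depend
only on finitely many binary variables, and every function on a finite discrete space is measurable.
-/
theorem measurable_of_offer_complier {n : ℕ} {β : Type*} [MeasurableSpace β]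
    (H : (Fin n → Bool × Bool) → β) :
    Measurable fun x : Fin n → Indiv k => H fun j => ((x j).Z, (x j).C) :=
  (measurable_of_finite H).comp measurable_offer_complier

theorem measurable_trueInstr (R : ℝ → ℕ → Matrix (Fin k) (Fin k) ℝ) {n : ℕ} (i : Fin n)
    (a : Fin k) : Measurable fun x : Fin n → Indiv k => trueInstr R (⟨n, x⟩ : Group k) i a := by
  simp only [trueInstr, Matrix.mulVec, dotProduct]
  refine Finset.measurable_fun_sum _ fun b _ => Measurable.mul ?_ (measurable_W i b)
  exact measurable_of_offer_complier fun z => (R ((∑ j ∈ Finset.univ.erase i,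
    if (z j).2 then (1 : ℝ) else 0) / ((n : ℝ) - 1)) n)⁻¹ a b

theorem measurable_estInstr (R : ℝ → ℕ → Matrix (Fin k) (Fin k) ℝ) {n : ℕ} (i : Fin n)
    (a : Fin k) : Measurable fun x : Fin n → Indiv k => estInstr R (⟨n, x⟩ : Group k) i a := by
  simp only [estInstr, Matrix.mulVec, dotProduct]
  refine Finset.measurable_fun_sum _ fun b _ => Measurable.mul ?_ (measurable_W i b)
  exact measurable_of_offer_complier fun z => mpinv (R (
    if 0 < (∑ j ∈ Finset.univ.erase i, if (z j).1 then (1 : ℝ) else 0) / ((n : ℝ) - 1) then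
      ((∑ j ∈ Finset.univ.erase i, if ((z j).2 && (z j).1) then (1 : ℝ) else 0) / ((n : ℝ) - 1)) /
      ((∑ j ∈ Finset.univ.erase i, if (z j).1 then (1 : ℝ) else 0) / ((n : ℝ) - 1))
    else 0) n) a b

theorem score_apply (P : Measure (Group k)) (R : ℝ → ℕ → Matrix (Fin k) (Fin k) ℝ) (s : Group k)
    (a : Fin k) : score P R s a
      = groupMean s fun i => rho P s * (trueInstr R s i a * (s.2 i).U) := by
  simp only [score, groupMean, Pi.smul_apply, Finset.sum_apply, smul_eq_mul]
  congr 1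
  exact Finset.sum_congr rfl fun i _ => by ring

theorem measurable_score (P : Measure (Group k)) (R : ℝ → ℕ → Matrix (Fin k) (Fin k) ℝ) :
    Measurable (score P R) := by
  refine measurable_pi_lambda _ fun a => ?_
  simp_rw [score_apply]
  refine measurable_group fun n => ?_
  refine Measurable.const_mul (f := fun x : Fin n → Indiv k => ∑ i : Fin n,
    (n : ℝ) / (∫ t : Group k, (t.1 : ℝ) ∂P) * (trueInstr R ⟨n, x⟩ i a * (x i).U)) ?_ (n : ℝ)⁻¹
  refine Finset.measurable_fun_sum _ fun i _ => Measurable.const_mul ?_ _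
  exact (measurable_trueInstr R i a).mul (measurable_U i)

theorem measurable_groupMean_trueInstr_mul_X (P : Measure (Group k))
    (R : ℝ → ℕ → Matrix (Fin k) (Fin k) ℝ) (a b : Fin k) :
    Measurable fun s : Group k =>
      groupMean s fun i => rho P s * (trueInstr R s i a * (s.2 i).X b) := by
  refine measurable_group fun n => ?_
  refine Measurable.const_mul (f := fun x : Fin n → Indiv k => ∑ i : Fin n,
    (n : ℝ) / (∫ t : Group k, (t.1 : ℝ) ∂P) * (trueInstr R ⟨n, x⟩ i a * (x i).X b)) ?_ (n : ℝ)⁻¹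
  refine Finset.measurable_fun_sum _ fun i _ => Measurable.const_mul ?_ _
  exact (measurable_trueInstr R i a).mul (measurable_X i b)

/-- The inverse is `det⁻¹` times the adjugate, also for singular matrices since `0⁻¹ = 0`;
determinant and adjugate are continuous in the entries. -/
theorem measurable_matrix_inv_apply {α : Type*} [MeasurableSpace α] {M : α → Matrix (Fin k) (Fin k) ℝ}
    (hM : ∀ a b, Measurable fun x => M x a b) (a b : Fin k) : Measurable fun x => (M x)⁻¹ a b := by
  have hM' : Measurable fun x (a b : Fin k) => M x a b :=
    measurable_pi_lambda _ fun a => measurable_pi_lambda _ fun b => hM a b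
  have hdet : Measurable fun x => (M x).det := by
    have : Continuous fun A : Fin k → Fin k → ℝ => (Matrix.of A).det :=
      Continuous.matrix_det continuous_id
    exact this.measurable.comp hM'
  have hadj : Measurable fun x => (M x).adjugate a b := by
    have : Continuous fun A : Fin k → Fin k → ℝ => (Matrix.of A).adjugate a b :=
      (Continuous.matrix_adjugate (A := fun A : Fin k → Fin k → ℝ => Matrix.of A)
        continuous_id).matrix_elem a b
    exact this.measurable.comp hM'
  simp only [Matrix.inv_def, Ring.inverse_eq_inv', Matrix.smul_apply, smul_eq_mul]
  exact hdet.inv.mul hadj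

theorem measurable_thetaHat (R : ℝ → ℕ → Matrix (Fin k) (Fin k) ℝ) (G : ℕ) :
    Measurable fun sample : Fin G → Group k => thetaHat R sample := by
  refine (WithLp.measurable_toLp 2 (Fin k → ℝ)).comp (measurable_pi_lambda _ fun a => ?_)
  simp only [Matrix.mulVec, dotProduct]
  refine Finset.measurable_fun_sum _ fun b _ => Measurable.mul ?_ ?_
  · refine measurable_matrix_inv_apply (fun c d => ?_) a b
    simp only [Matrix.sum_apply, vecMulVec_apply]
    refine Finset.measurable_fun_sum _ fun g _ => ?_
    have : Measurable fun s : Group k => ∑ i, estInstr R s i c * (s.2 i).X d :=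
      measurable_group fun n => Finset.measurable_fun_sum (Finset.univ : Finset (Fin n))
        (f := fun i x => estInstr R ⟨n, x⟩ i c * (x i).X d) fun i _ =>
        (measurable_estInstr R i c).mul (measurable_X i d)
    exact this.comp (measurable_pi_apply g)
  · simp only [Finset.sum_apply, Pi.smul_apply, smul_eq_mul]
    refine Finset.measurable_fun_sum _ fun g _ => ?_
    have : Measurable fun s : Group k => ∑ i, (s.2 i).Y * estInstr R s i b :=
      measurable_group fun n => Finset.measurable_fun_sum (Finset.univ : Finset (Fin n))
        (f := fun i x => (x i).Y * estInstr R ⟨n, x⟩ i b) fun i _ =>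
        (measurable_Y i).mul (measurable_estInstr R i b)
    exact this.comp (measurable_pi_apply g)

/-! ### Group means -/

theorem rho_nonneg (P : Measure (Group k)) (s : Group k) : 0 ≤ rho P s :=
  div_nonneg (Nat.cast_nonneg _) (integral_nonneg fun _ => Nat.cast_nonneg _)

theorem groupMean_mono {s : Group k} {u v : Fin s.1 → ℝ} (h : ∀ i, u i ≤ v i) :
    groupMean s u ≤ groupMean s v := by
  simp only [groupMean, smul_eq_mul]
  gcongr with i
  exact h i

/-- Jensen's inequality for the within-group average. -/
theorem norm_groupMean_rpow_le {V : Type*} [NormedAddCommGroup V] [NormedSpace ℝ V] (s : Group k)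
    (v : Fin s.1 → V) {p : ℝ} (hp : 1 ≤ p) :
    ‖groupMean s v‖ ^ p ≤ groupMean s fun i => ‖v i‖ ^ p := by
  simp only [groupMean, smul_eq_mul]
  -- The type of groups admits size 0; there both sides vanish because `p ≠ 0`.
  rcases Nat.eq_zero_or_pos s.1 with h0 | h0
  · simp [h0, Real.zero_rpow (by linarith : p ≠ 0)]
  · have hn : (0 : ℝ) < s.1 := by exact_mod_cast h0
    have h1 : ‖(s.1 : ℝ)⁻¹ • ∑ i, v i‖ ≤ ∑ i : Fin s.1, (s.1 : ℝ)⁻¹ * ‖v i‖ := by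
      rw [norm_smul, ← Finset.mul_sum, Real.norm_of_nonneg (by positivity)]
      gcongr
      exact norm_sum_le _ _
    refine (Real.rpow_le_rpow (norm_nonneg _) h1 (by linarith)).trans ?_
    rw [Finset.mul_sum]
    refine Real.rpow_arith_mean_le_arith_mean_rpow _ _ _ (fun _ _ => by positivity) ?_
      (fun _ _ => norm_nonneg _) hp
    simp [hn.ne']

theorem norm_groupMean_sq_le {V : Type*} [NormedAddCommGroup V] [NormedSpace ℝ V] (s : Group k)
    (v : Fin s.1 → V) : ‖groupMean s v‖ ^ 2 ≤ groupMean s fun i => ‖v i‖ ^ 2 := by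
  have := norm_groupMean_rpow_le s v (p := 2) (by norm_num)
  exact_mod_cast this

theorem toLp_groupMean (s : Group k) (v : Fin s.1 → Fin k → ℝ) :
    WithLp.toLp 2 (groupMean s v)
      = groupMean s fun i => (WithLp.toLp 2 (v i) : EuclideanSpace ℝ (Fin k)) := by
  simp [groupMean, WithLp.toLp_sum]

theorem toLp_score (P : Measure (Group k)) (R : ℝ → ℕ → Matrix (Fin k) (Fin k) ℝ) (s : Group k) :
    WithLp.toLp 2 (score P R s) = groupMean s fun i =>
      rho P s • (WithLp.toLp 2 ((s.2 i).U • trueInstr R s i) : EuclideanSpace ℝ (Fin k)) := by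
  rw [score, toLp_groupMean]
  simp [mul_smul]

/-- Jensen's inequality over the members: moments of the group score are bounded by individual
moments, whatever the dependence within the group. -/
theorem vnorm_score_rpow_le (P : Measure (Group k)) (R : ℝ → ℕ → Matrix (Fin k) (Fin k) ℝ)
    (s : Group k) {p : ℝ} (hp : 1 ≤ p) :
    vnorm (score P R s) ^ p ≤ groupMean s fun i =>
      rho P s ^ p * vnorm ((s.2 i).U • trueInstr R s i) ^ p := by
  rw [vnorm, toLp_score]
  refine (norm_groupMean_rpow_le s _ hp).trans_eq ?_
  congr 1
  ext i
  rw [norm_smul, Real.norm_of_nonneg (rho_nonneg P s),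
    Real.mul_rpow (rho_nonneg P s) (norm_nonneg _)]
  rfl

theorem vnorm_score_sq_le (P : Measure (Group k)) (R : ℝ → ℕ → Matrix (Fin k) (Fin k) ℝ)
    (s : Group k) :
    vnorm (score P R s) ^ 2 ≤ groupMean s fun i =>
      rho P s ^ 2 * vnorm ((s.2 i).U • trueInstr R s i) ^ 2 := by
  have := vnorm_score_rpow_le P R s (p := 2) (by norm_num)
  exact_mod_cast this

theorem abs_apply_le_frobenius_norm (M : Matrix (Fin k) (Fin k) ℝ) (a b : Fin k) :
    |M a b| ≤ ‖M‖ := by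
  rw [Matrix.frobenius_norm_def]
  have h : M a b ^ 2 ≤ ∑ i, ∑ j, ‖M i j‖ ^ (2 : ℝ) := by
    have h1 : M a b ^ 2 = ‖M a b‖ ^ (2 : ℝ) := by
      rw [← sq_abs, ← Real.norm_eq_abs]; exact_mod_cast rfl
    rw [h1]
    refine (Finset.single_le_sum (f := fun j => ‖M a j‖ ^ (2 : ℝ)) (fun j _ => by positivity)
      (Finset.mem_univ b)).trans ?_
    exact Finset.single_le_sum (f := fun i => ∑ j, ‖M i j‖ ^ (2 : ℝ))
      (fun i _ => Finset.sum_nonneg fun j _ => by positivity) (Finset.mem_univ a)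
  rw [← Real.sqrt_eq_rpow, ← Real.sqrt_sq_eq_abs]
  exact Real.sqrt_le_sqrt h

theorem groupMean_trueInstr_mul_X_sq_le (P : Measure (Group k))
    (R : ℝ → ℕ → Matrix (Fin k) (Fin k) ℝ) (a b : Fin k) (s : Group k) :
    (groupMean s fun i => rho P s * (trueInstr R s i a * (s.2 i).X b)) ^ 2
      ≤ groupMean s fun i => rho P s ^ 2 * ‖vecMulVec (trueInstr R s i) (s.2 i).X‖ ^ 2 := by
  rw [← sq_abs, ← Real.norm_eq_abs]
  refine (norm_groupMean_sq_le s _).trans (groupMean_mono fun i => ?_)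
  rw [Real.norm_eq_abs, sq_abs, mul_pow]
  gcongr 1
  have := abs_apply_le_frobenius_norm (vecMulVec (trueInstr R s i) (s.2 i).X) a b
  rw [vecMulVec_apply] at this
  rw [← sq_abs]
  gcongr

theorem IsLittle.of_le {T T' : ℕ → ℝ≥0∞} {r : ℕ → ℝ} (h : IsLittle T r) {C : ℝ≥0∞} (hC : C ≠ ∞)
    (hle : ∀ G, T' G ≤ C * T G) : IsLittle T' r := by
  have := ENNReal.Tendsto.const_mul h (a := C) (Or.inr hC)
  rw [mul_zero] at this
  refine tendsto_of_tendsto_of_tendsto_of_le_of_le tendsto_const_nhds this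
    (fun _ => zero_le) fun G => ?_
  simp only
  rw [← mul_div_assoc]
  gcongr
  exact hle G

end RandSat

namespace RandSat

variable {k : ℕ}

/-! ### The estimator in terms of group means -/

/-- For a nonempty group `rho / N = 1 / E(N)`, the same constant for every group; for an empty one
both sides are 0. -/
theorem sum_eq_smul_groupMean {V : Type*} [AddCommGroup V] [Module ℝ V] {P : Measure (Group k)}
    (hP : 0 < ∫ t : Group k, (t.1 : ℝ) ∂P) (s : Group k) (v : Fin s.1 → V) :
    ∑ i, v i = (∫ t : Group k, (t.1 : ℝ) ∂P) • groupMean s fun i => rho P s • v i := by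
  rw [groupMean, ← Finset.smul_sum, smul_smul, smul_smul, rho]
  rcases Nat.eq_zero_or_pos s.1 with h0 | h0
  · have : IsEmpty (Fin s.1) := by rw [h0]; infer_instance
    simp
  · have hn : (s.1 : ℝ) ≠ 0 := by exact_mod_cast h0.ne'
    have : (∫ t : Group k, (t.1 : ℝ) ∂P) * ((s.1 : ℝ)⁻¹ * ((s.1 : ℝ) / ∫ t : Group k, (t.1 : ℝ) ∂P))
        = 1 := by field_simp
    rw [mul_assoc, this, one_smul]

/-- With `c = E(N)`, the matrix of the estimator is `M = c G A` and its vector is `M ϑ + c w`, so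
`c` cancels and `ϑ̂ - ϑ = G⁻¹ A⁻¹ w`. -/
theorem sqrt_smul_thetaHat_sub {P : Measure (Group k)} (hP : 0 < ∫ t : Group k, (t.1 : ℝ) ∂P)
    (R : ℝ → ℕ → Matrix (Fin k) (Fin k) ℝ) (ϑ : EuclideanSpace ℝ (Fin k)) {G : ℕ} (hG : 0 < G)
    (sample : Fin G → Group k)
    (hmodel : ∀ g i, ((sample g).2 i).Y = ((sample g).2 i).X ⬝ᵥ ϑ.ofLp + ((sample g).2 i).U)
    {A : Matrix (Fin k) (Fin k) ℝ} (hA : A = (G : ℝ)⁻¹ • ∑ g, groupMean (sample g) fun i =>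
      rho P (sample g) • vecMulVec (estInstr R (sample g) i) ((sample g).2 i).X)
    (hdet : IsUnit A.det) :
    √(G : ℝ) • (thetaHat R sample - ϑ) = WithLp.toLp 2 (A⁻¹ *ᵥ ((√(G : ℝ))⁻¹ • ∑ g,
      groupMean (sample g) fun i =>
        (rho P (sample g) * ((sample g).2 i).U) • estInstr R (sample g) i)) := by
  set c := ∫ t : Group k, (t.1 : ℝ) ∂P
  have hGr : (0 : ℝ) < G := by exact_mod_cast hG
  set w := ∑ g, groupMean (sample g) fun i =>
        (rho P (sample g) * ((sample g).2 i).U) • estInstr R (sample g) i with hw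
  set M := ∑ g, ∑ i, vecMulVec (estInstr R (sample g) i) ((sample g).2 i).X with hM
  have hMA : M = (c * G) • A := by
    rw [hA, smul_smul, mul_assoc, mul_inv_cancel₀ hGr.ne', mul_one, hM, Finset.smul_sum]
    exact Finset.sum_congr rfl fun g _ => sum_eq_smul_groupMean hP _ _
  have hMinv : M⁻¹ = (c * G)⁻¹ • A⁻¹ := by
    refine Matrix.inv_eq_right_inv ?_
    rw [hMA, Matrix.smul_mul, Matrix.mul_smul, smul_smul, mul_inv_cancel₀ (by positivity),
      one_smul, Matrix.mul_nonsing_inv _ hdet]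
  have hY : ∑ g, ∑ i, ((sample g).2 i).Y • estInstr R (sample g) i = M *ᵥ ϑ.ofLp + c • w := by
    rw [hM, hw, Matrix.sum_mulVec, Finset.smul_sum, ← Finset.sum_add_distrib]
    refine Finset.sum_congr rfl fun g _ => ?_
    simp_rw [mul_smul]
    rw [← sum_eq_smul_groupMean hP (sample g)
      (fun i => ((sample g).2 i).U • estInstr R (sample g) i), Matrix.sum_mulVec,
      ← Finset.sum_add_distrib]
    refine Finset.sum_congr rfl fun i _ => ?_
    rw [hmodel, add_smul, Matrix.vecMulVec_mulVec]
    simp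
  have hMM : M⁻¹ * M = 1 := by
    rw [hMinv, hMA, Matrix.smul_mul, Matrix.mul_smul, smul_smul, inv_mul_cancel₀ (by positivity),
      one_smul, Matrix.nonsing_inv_mul _ hdet]
  have hθ : thetaHat R sample - ϑ = WithLp.toLp 2 ((G : ℝ)⁻¹ • A⁻¹ *ᵥ w) := by
    rw [thetaHat, hY, Matrix.mulVec_add, Matrix.mulVec_mulVec, hMM, Matrix.one_mulVec, hMinv,
      Matrix.mulVec_smul, Matrix.smul_mulVec, smul_smul, WithLp.toLp_add, add_sub_cancel_left]
    congr 2
    field_simp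
  rw [hθ, ← WithLp.toLp_smul, Matrix.mulVec_smul, smul_smul]
  congr 2
  rw [inv_eq_one_div, inv_eq_one_div, mul_one_div, Real.sqrt_div_self']

/-! ### The scores -/

theorem vnorm_eq_sqrt (v : Fin k → ℝ) : vnorm v = √(∑ a, v a ^ 2) := by
  simp [vnorm, EuclideanSpace.norm_eq]

theorem abs_apply_le_vnorm (v : Fin k → ℝ) (a : Fin k) : |v a| ≤ vnorm v := by
  rw [vnorm_eq_sqrt, ← Real.sqrt_sq_eq_abs]
  exact Real.sqrt_le_sqrt (Finset.single_le_sum (f := fun a => v a ^ 2)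
    (fun _ _ => sq_nonneg _) (Finset.mem_univ a))

theorem memLp_score_apply {P : Measure (Group k)} {R : ℝ → ℕ → Matrix (Fin k) (Fin k) ℝ}
    (h : indivExpNonneg P (fun s i =>
      rho P s ^ 2 * vnorm ((s.2 i).U • trueInstr R s i) ^ 2) < ∞) (a : Fin k) :
    MemLp (fun s => score P R s a) 2 P := by
  have hm : Measurable fun s => score P R s a := (measurable_pi_apply a).comp (measurable_score P R)
  refine (memLp_two_iff_integrable_sq hm.aestronglyMeasurable).2
    ⟨(hm.pow_const 2).aestronglyMeasurable, ?_⟩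
  rw [hasFiniteIntegral_iff_ofReal (ae_of_all _ fun x => by positivity)]
  refine lt_of_le_of_lt (lintegral_mono fun s => ENNReal.ofReal_le_ofReal ?_) h
  refine le_trans ?_ (vnorm_score_sq_le P R s)
  rw [← sq_abs]
  gcongr
  exact abs_apply_le_vnorm _ _

theorem inner_toLp_score (P : Measure (Group k)) (R : ℝ → ℕ → Matrix (Fin k) (Fin k) ℝ)
    (t : EuclideanSpace ℝ (Fin k)) (s : Group k) :
    inner ℝ (WithLp.toLp 2 (score P R s)) t = ∑ a, t a * score P R s a := by
  simp [PiLp.inner_apply]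

theorem integral_score_apply {P : Measure (Group k)} {R : ℝ → ℕ → Matrix (Fin k) (Fin k) ℝ}
    {a : Fin k} (h : indivExp P (fun s i => rho P s * (trueInstr R s i a * (s.2 i).U)) = 0) :
    ∫ s, score P R s a ∂P = 0 := by
  simp_rw [score_apply]
  exact h

theorem variance_sum_mul_eq {α : Type*} [MeasurableSpace α] {P : Measure α} [IsProbabilityMeasure P]
    {V : α → Fin k → ℝ} (hV : ∀ a, MemLp (fun s => V s a) 2 P) (t : Fin k → ℝ) :
    Var[fun s => ∑ a, t a * V s a; P] = t ⬝ᵥ covMatrix P V *ᵥ t := by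
  rw [variance_fun_sum fun a => (hV a).const_mul (t a)]
  simp only [dotProduct, Matrix.mulVec, covMatrix, Matrix.of_apply, Finset.mul_sum]
  refine Finset.sum_congr rfl fun a _ => Finset.sum_congr rfl fun b _ => ?_
  rw [covariance_const_mul_left, covariance_const_mul_right]
  ring

theorem tendsto_dotProduct_mulVec {M : ℕ → Matrix (Fin k) (Fin k) ℝ} {N : Matrix (Fin k) (Fin k) ℝ}
    (h : Tendsto M atTop (𝓝 N)) (t : Fin k → ℝ) :
    Tendsto (fun G => t ⬝ᵥ M G *ᵥ t) atTop (𝓝 (t ⬝ᵥ N *ᵥ t)) := by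
  have : Continuous fun A : Matrix (Fin k) (Fin k) ℝ => t ⬝ᵥ A *ᵥ t :=
    continuous_const.dotProduct (continuous_id.matrix_mulVec continuous_const)
  exact (this.tendsto N).comp h

/-- A limit of covariance matrices is positive semidefinite. -/
theorem posSemidef_of_tendsto_covMatrix {α : ℕ → Type*} [∀ G, MeasurableSpace (α G)]
    {P : ∀ G, Measure (α G)} [∀ G, IsProbabilityMeasure (P G)] {V : ∀ G, α G → Fin k → ℝ}
    (hV : ∀ᶠ G in atTop, ∀ a, MemLp (fun s => V G s a) 2 (P G)) {Sig : Matrix (Fin k) (Fin k) ℝ}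
    (h : Tendsto (fun G => covMatrix (P G) (V G)) atTop (𝓝 Sig)) : Sig.PosSemidef := by
  refine Matrix.PosSemidef.of_dotProduct_mulVec_nonneg ?_ fun t => ?_
  · rw [Matrix.IsHermitian, Matrix.conjTranspose_eq_transpose_of_trivial]
    have h1 : Tendsto (fun G => (covMatrix (P G) (V G))ᵀ) atTop (𝓝 Sigᵀ) :=
      (continuous_id.matrix_transpose.tendsto Sig).comp h
    refine tendsto_nhds_unique h1 (h.congr fun G => ?_)
    ext a b
    simp [covMatrix, covariance_comm]
  · rw [star_trivial]
    refine ge_of_tendsto (tendsto_dotProduct_mulVec h t) ?_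
    filter_upwards [hV] with G hG
    rw [← variance_sum_mul_eq hG t]
    exact variance_nonneg _ _

/-- Cauchy-Schwarz and Jensen: each projection inherits Lyapunov's condition, with a factor `‖t‖ ^
p` that does not depend on `G`. -/
theorem lintegral_inner_score_rpow_le {P : Measure (Group k)}
    {R : ℝ → ℕ → Matrix (Fin k) (Fin k) ℝ} (t : EuclideanSpace ℝ (Fin k)) {p : ℝ} (hp : 1 ≤ p) :
    ∫⁻ s, ENNReal.ofReal (|inner ℝ (WithLp.toLp 2 (score P R s)) t| ^ p) ∂P
      ≤ ENNReal.ofReal (‖t‖ ^ p) * indivExpNonneg P fun s i =>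
        rho P s ^ p * vnorm ((s.2 i).U • trueInstr R s i) ^ p := by
  rw [indivExpNonneg, ← lintegral_const_mul' _ _ ENNReal.ofReal_ne_top]
  refine lintegral_mono fun s => ?_
  rw [← ENNReal.ofReal_mul (by positivity)]
  refine ENNReal.ofReal_le_ofReal ?_
  calc _ ≤ (‖(WithLp.toLp 2 (score P R s) : EuclideanSpace ℝ (Fin k))‖ * ‖t‖) ^ p := by
        gcongr
        exact abs_real_inner_le_norm _ _
    _ = ‖t‖ ^ p * vnorm (score P R s) ^ p := by
        rw [Real.mul_rpow (norm_nonneg _) (norm_nonneg _), mul_comm]; rfl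
    _ ≤ _ := by
        gcongr
        exact vnorm_score_rpow_le P R s hp

/-- Independence gives a product of `G` equal factors. Each involves only the scalar `⟨V, t⟩`, so a
one-dimensional limit theorem suffices (the Cramér-Wold device). -/
theorem charFun_map_smul_sum {Ω α : Type*} [MeasurableSpace Ω] [MeasurableSpace α]
    {μ : Measure Ω} {P : Measure α} {G : ℕ}
    {S : Fin G → Ω → α} (h_law : ∀ g, HasLaw (S g) P μ) (h_indep : iIndepFun S μ)
    {E : Type*} [NormedAddCommGroup E] [InnerProductSpace ℝ E] [FiniteDimensional ℝ E]
    [MeasurableSpace E] [BorelSpace E] {V : α → E} (hV : Measurable V) (c : ℝ) (t : E) :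
    charFun (μ.map fun ω => c • ∑ g, V (S g ω)) t
      = (∫ s, Complex.exp ((c * inner ℝ (V s) t : ℝ) * Complex.I) ∂P) ^ G := by
  have hm : ∀ g, AEMeasurable (fun ω => c • V (S g ω)) μ := fun g =>
    (hV.const_smul c).comp_aemeasurable (h_law g).aemeasurable
  have hi : iIndepFun (fun g ω => c • V (S g ω)) μ :=
    h_indep.comp (fun _ s => c • V s) fun _ => hV.const_smul c
  simp_rw [Finset.smul_sum]
  rw [hi.charFun_map_fun_sum_eq_prod hm]
  have hone : ∀ g, charFun (μ.map fun ω => c • V (S g ω)) t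
      = ∫ s, Complex.exp ((c * inner ℝ (V s) t : ℝ) * Complex.I) ∂P := fun g => by
    rw [charFun_apply, integral_map (hm g) (by fun_prop)]
    simp_rw [real_inner_smul_left]
    exact (h_law g).integral_comp
      (f := fun s => Complex.exp ((c * inner ℝ (V s) t : ℝ) * Complex.I))
      (by fun_prop : Measurable _).aestronglyMeasurable
  simp only [Finset.prod_apply, hone]
  simp

end RandSat

/-! ### Assembly of the limit theorem -/

namespace RandSat

variable {k : ℕ}

/-- If `A_G → 1` and `e_G → 0` in probability and `X_G` converges to `ν` in distribution, then so
does `A_G⁻¹ (X_G + e_G)`. -/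
theorem tendstoInDistribution_inv_mulVec {Ω : ℕ → Type*} [∀ G, MeasurableSpace (Ω G)]
    {μ : ∀ G, Measure (Ω G)} [∀ G, IsProbabilityMeasure (μ G)]
    {ν : Measure (EuclideanSpace ℝ (Fin k))} [IsProbabilityMeasure ν]
    {X T e : ∀ G, Ω G → EuclideanSpace ℝ (Fin k)} {A : ∀ G, Ω G → Matrix (Fin k) (Fin k) ℝ}
    (hX : ∀ G, AEMeasurable (X G) (μ G)) (hT : ∀ G, AEMeasurable (T G) (μ G))
    (hchar : ∀ t, Tendsto (fun G => charFun ((μ G).map (X G)) t) atTop (𝓝 (charFun ν t)))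
    (hA : TendstoZeroInProb μ fun G ω => A G ω - 1) (he : TendstoZeroInProb μ e)
    (h : ∀ᶠ G in atTop, ∀ᵐ ω ∂(μ G), IsUnit (A G ω).det →
      T G ω = WithLp.toLp 2 ((A G ω)⁻¹ *ᵥ (X G ω + e G ω).ofLp)) :
    TendstoInDistribution T atTop
      (id : EuclideanSpace ℝ (Fin k) → EuclideanSpace ℝ (Fin k)) μ ν := by
  refine tendstoInDistribution_of_charFun_of_sub hX hT hchar ?_
  refine (hA.prodMk he).of_control_of_charFun hX hchar fun ε M hε => ?_
  obtain ⟨η, hη, hctrl⟩ := exists_isUnit_det_norm_inv_mulVec_sub_lt (n := Fin k) (M := M) hε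
  refine ⟨η, hη, h.mono fun G hG => hG.mono fun ω hω hAe hM => ?_⟩
  obtain ⟨h1, h2⟩ := max_lt_iff.1 hAe
  obtain ⟨hdet, hlt⟩ := hctrl _ _ _ h1 h2 hM
  rwa [hω hdet]

theorem smul_sum_score_add (P : Measure (Group k)) (R : ℝ → ℕ → Matrix (Fin k) (Fin k) ℝ) {G : ℕ}
    (sample : Fin G → Group k) (c : ℝ) :
    (c • ∑ g, (WithLp.toLp 2 (score P R (sample g)) : EuclideanSpace ℝ (Fin k))
      + c • WithLp.toLp 2 (∑ g, groupMean (sample g) fun i =>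
        (rho P (sample g) * ((sample g).2 i).U) •
        (estInstr R (sample g) i - trueInstr R (sample g) i))).ofLp
      = c • ∑ g, groupMean (sample g) fun i =>
        (rho P (sample g) * ((sample g).2 i).U) • estInstr R (sample g) i := by
  rw [← WithLp.toLp_sum, ← WithLp.toLp_smul, ← WithLp.toLp_smul, ← WithLp.toLp_add, ← smul_add,
    ← Finset.sum_add_distrib]
  simp only [score, groupMean, ← smul_add, ← Finset.sum_add_distrib, add_sub_cancel]

theorem frobenius_norm_smul (c : ℝ) (M : Matrix (Fin k) (Fin k) ℝ) : ‖c • M‖ = ‖c‖ * ‖M‖ :=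
  letI := Matrix.frobeniusNormedSpace (m := Fin k) (n := Fin k) (R := ℝ) (α := ℝ)
  norm_smul c M

/-- Split `Ẑ = 𝒵 + (Ẑ - 𝒵)`. The second part is negligible by assumption; the first obeys the weak
law entry by entry, with mean the identity by the relevance condition. -/
theorem tendstoZeroInProb_relevance_sub_one {Ω : ℕ → Type*} [∀ G, MeasurableSpace (Ω G)]
    {R : ℕ → ℝ → ℕ → Matrix (Fin k) (Fin k) ℝ} {P : ℕ → Measure (Group k)}
    {μ : ∀ G, Measure (Ω G)} [∀ G, IsProbabilityMeasure (μ G)]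
    {S : ∀ G : ℕ, Fin G → Ω G → Group k} (h_law : ∀ G g, HasLaw (S G g) (P G) (μ G))
    (h_indep : ∀ G, iIndepFun (S G) (μ G))
    (h_relev : ∀ G a b, indivExp (P G)
      (fun s i => rho (P G) s * (trueInstr (R G) s i a * (s.2 i).X b)) =
        (1 : Matrix (Fin k) (Fin k) ℝ) a b)
    (h_momX : IsLittle (fun G => indivExpNonneg (P G) fun s i =>
      rho (P G) s ^ 2 * ‖vecMulVec (trueInstr (R G) s i) (s.2 i).X‖ ^ 2) (fun G => (G : ℝ)))
    (h_errX : IsLittleP μ (fun G ω => ‖∑ g, groupMean (S G g ω) fun i =>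
      rho (P G) (S G g ω) • vecMulVec
        (estInstr (R G) (S G g ω) i - trueInstr (R G) (S G g ω) i)
        ((S G g ω).2 i).X‖) (fun G => (G : ℝ))) :
    TendstoZeroInProb μ (fun G ω => (G : ℝ)⁻¹ • (∑ g, groupMean (S G g ω) fun i =>
      rho (P G) (S G g ω) • vecMulVec (estInstr (R G) (S G g ω) i) ((S G g ω).2 i).X) - 1) := by
  let m : ∀ _ : Fin k × Fin k, ∀ _ : ℕ, Group k → ℝ := fun ab G s =>
    groupMean s fun i => rho (P G) s * (trueInstr (R G) s i ab.1 * (s.2 i).X ab.2)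
  have hentry : ∀ ab : Fin k × Fin k, TendstoZeroInProb μ (fun G ω =>
      (G : ℝ)⁻¹ * ∑ g, m ab G (S G g ω) - (1 : Matrix (Fin k) (Fin k) ℝ) ab.1 ab.2) := fun ab =>
    tendstoZeroInProb_mean_sub h_law h_indep
      (fun G => measurable_groupMean_trueInstr_mul_X (P G) (R G) ab.1 ab.2)
      (fun G => h_relev G ab.1 ab.2)
      (h_momX.of_le (C := 1) ENNReal.one_ne_top fun G => by
        rw [one_mul]
        exact lintegral_mono fun s => ENNReal.ofReal_le_ofReal
          (groupMean_trueInstr_mul_X_sq_le (P G) (R G) ab.1 ab.2 s))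
  -- The matrix is rebuilt from its entries as a finite sum of multiples of `Matrix.single`, each of
  -- Frobenius norm 1.
  have hentry' := TendstoZeroInProb.sum (Finset.univ : Finset (Fin k × Fin k))
    (T := fun ab G ω => ((G : ℝ)⁻¹ * ∑ g, m ab G (S G g ω)
      - (1 : Matrix (Fin k) (Fin k) ℝ) ab.1 ab.2) • Matrix.single ab.1 ab.2 (1 : ℝ)) fun ab => by
    refine (hentry ab).of_norm_le (Eventually.of_forall fun G => ae_of_all _ fun ω => ?_)
    rw [frobenius_norm_smul]
    have : ‖Matrix.single ab.1 ab.2 (1 : ℝ)‖ = 1 := by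
      rw [Matrix.frobenius_norm_def, Finset.sum_eq_single ab.1, Finset.sum_eq_single ab.2]
      · simp
      · intro b _ hb; simp [hb.symm]
      · simp
      · intro a _ ha; simp [ha.symm]
      · simp
    rw [this, mul_one]
  have herr := h_errX.tendstoZeroInProb
    (by filter_upwards [eventually_gt_atTop 0] with G hG; exact_mod_cast hG)
  have herr' : TendstoZeroInProb μ (fun G ω => (G : ℝ)⁻¹ • ∑ g, groupMean (S G g ω) fun i =>
      rho (P G) (S G g ω) • vecMulVec
        (estInstr (R G) (S G g ω) i - trueInstr (R G) (S G g ω) i) ((S G g ω).2 i).X) :=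
    herr.of_norm_le (Eventually.of_forall fun G => ae_of_all _ fun ω => by
      rw [frobenius_norm_smul, norm_mul, norm_norm])
  refine (herr'.add hentry').of_norm_le (Eventually.of_forall fun G => ae_of_all _ fun ω => ?_)
  set N : Matrix (Fin k) (Fin k) ℝ := (G : ℝ)⁻¹ • ∑ g, groupMean (S G g ω) fun i =>
    rho (P G) (S G g ω) • vecMulVec (trueInstr (R G) (S G g ω) i) ((S G g ω).2 i).X with hN
  have hNm : ∀ ab : Fin k × Fin k, (G : ℝ)⁻¹ * ∑ g, m ab G (S G g ω)
      - (1 : Matrix (Fin k) (Fin k) ℝ) ab.1 ab.2 = (N - 1) ab.1 ab.2 := fun ab => by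
    simp only [hN, m, groupMean, Matrix.sub_apply, Matrix.smul_apply, Matrix.sum_apply,
      vecMulVec_apply, smul_eq_mul]
  have hsingle : ∑ ab : Fin k × Fin k, (N - 1) ab.1 ab.2 • Matrix.single ab.1 ab.2 (1 : ℝ)
      = N - 1 := by
    rw [Fintype.sum_prod_type]
    conv_rhs => rw [Matrix.matrix_eq_sum_single (N - 1)]
    simp [Matrix.smul_single]
  simp_rw [hNm]
  rw [hsingle, hN, ← add_sub_assoc, ← smul_add, ← Finset.sum_add_distrib]
  simp only [groupMean, ← smul_add, ← Finset.sum_add_distrib, ← Matrix.add_vecMulVec,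
    sub_add_cancel, le_refl]

theorem tendsto_charFun_map_score {Ω : ℕ → Type*} [∀ G, MeasurableSpace (Ω G)]
    {R : ℕ → ℝ → ℕ → Matrix (Fin k) (Fin k) ℝ} {P : ℕ → Measure (Group k)}
    [∀ G, IsProbabilityMeasure (P G)] {μ : ∀ G, Measure (Ω G)}
    {S : ∀ G : ℕ, Fin G → Ω G → Group k} (h_law : ∀ G g, HasLaw (S G g) (P G) (μ G))
    (h_indep : ∀ G, iIndepFun (S G) (μ G))
    (h_exog : ∀ G a, indivExp (P G)
      (fun s i => rho (P G) s * (trueInstr (R G) s i a * (s.2 i).U)) = 0)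
    (h_momU : IsLittle (fun G => indivExpNonneg (P G) fun s i =>
      rho (P G) s ^ 2 * vnorm ((s.2 i).U • trueInstr (R G) s i) ^ 2) (fun G => (G : ℝ)))
    {Sig : Matrix (Fin k) (Fin k) ℝ}
    (h_var : Tendsto (fun G => covMatrix (P G) (score (P G) (R G))) atTop (𝓝 Sig))
    {δ : ℝ} (hδ : 0 < δ) (h_lyap : IsLittle (fun G => indivExpNonneg (P G) fun s i =>
      rho (P G) s ^ (2 + δ) * vnorm ((s.2 i).U • trueInstr (R G) s i) ^ (2 + δ))
      (fun G => (G : ℝ) ^ (δ / 2))) (t : EuclideanSpace ℝ (Fin k)) :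
    Tendsto (fun G : ℕ => charFun ((μ G).map fun ω => (√(G : ℝ))⁻¹ • ∑ g,
      (WithLp.toLp 2 (score (P G) (R G) (S G g ω)) : EuclideanSpace ℝ (Fin k))) t) atTop
      (𝓝 (charFun (multivariateGaussian 0 Sig) t)) := by
  have hL2 : ∀ᶠ G in atTop, ∀ a, MemLp (fun s => score (P G) (R G) s a) 2 (P G) :=
    h_momU.eventually_lt_top.mono fun G hG a => memLp_score_apply hG a
  -- The formula used for the Gaussian characteristic function requires this; it is not assumed, but
  -- inherited from the covariance matrices. `Sig` may be singular.
  have hSig : Sig.PosSemidef := posSemidef_of_tendsto_covMatrix hL2 h_var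
  have hf2 : ∀ᶠ G in atTop, MemLp (fun s => inner ℝ
      (WithLp.toLp 2 (score (P G) (R G) s) : EuclideanSpace ℝ (Fin k)) t) 2 (P G) := by
    filter_upwards [hL2] with G hG
    simp_rw [inner_toLp_score]
    exact memLp_finsetSum _ fun a _ => (hG a).const_mul (t a)
  have hf0 : ∀ᶠ G in atTop, ∫ s, inner ℝ
      (WithLp.toLp 2 (score (P G) (R G) s) : EuclideanSpace ℝ (Fin k)) t ∂(P G) = 0 := by
    filter_upwards [hL2] with G hG
    simp_rw [inner_toLp_score]
    rw [integral_finsetSum _ fun a _ => ((hG a).integrable (by norm_num)).const_mul (t a)]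
    simp_rw [integral_const_mul, fun a => integral_score_apply (h_exog G a)]
    simp
  have hlim := tendsto_charFun_pow_of_lyapunov P (fun G s => inner ℝ
    (WithLp.toLp 2 (score (P G) (R G) s) : EuclideanSpace ℝ (Fin k)) t)
    (v := t.ofLp ⬝ᵥ Sig *ᵥ t.ofLp) hδ hf2 hf0 ?_ ?_
  · rw [charFun_multivariateGaussian hSig]
    refine (hlim.congr fun G => ?_).trans_eq ?_
    · exact (charFun_map_smul_sum (h_law G) (h_indep G)
        ((WithLp.measurable_toLp 2 (Fin k → ℝ)).comp (measurable_score (P G) (R G))) _ t).symm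
    · congr 2
      simp [neg_div]
  · refine (tendsto_dotProduct_mulVec h_var t.ofLp).congr' ?_
    filter_upwards [hL2, hf2, hf0] with G hG h2 h0
    rw [← variance_sum_mul_eq hG, ← variance_of_integral_eq_zero h2.aestronglyMeasurable.aemeasurable h0]
    simp_rw [inner_toLp_score]
  · exact h_lyap.of_le ENNReal.ofReal_ne_top fun G =>
      lintegral_inner_score_rpow_le t (by linarith)

end RandSat

theorem mainTheorem5 {k : ℕ} (ϑ : EuclideanSpace ℝ (Fin k))
    (R : ℕ → ℝ → ℕ → Matrix (Fin k) (Fin k) ℝ)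
    (P : ℕ → Measure (RandSat.Group k)) [∀ G, IsProbabilityMeasure (P G)]
    (hN2 : ∀ G, ∀ᵐ s ∂(P G), 2 ≤ s.1)
    (hN : ∀ G, Integrable (fun s : RandSat.Group k => (s.1 : ℝ)) (P G))
    {Ω : ℕ → Type*} [∀ G, MeasurableSpace (Ω G)]
    (μ : ∀ G, Measure (Ω G)) [∀ G, IsProbabilityMeasure (μ G)]
    (S : ∀ G : ℕ, Fin G → Ω G → RandSat.Group k)
    -- random sample of `G` groups, members of a group identically distributed
    (h_law : ∀ G g, HasLaw (S G g) (P G) (μ G))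
    (h_indep : ∀ G, iIndepFun (S G) (μ G))
    (h_within : ∀ G, RandSat.IdentDistribWithin (P G))
    -- the linear model
    (h_model : ∀ G, ∀ᵐ s ∂(P G), ∀ i, (s.2 i).Y = (s.2 i).X ⬝ᵥ ϑ.ofLp + (s.2 i).U)
    -- exogeneity and relevance of the true instrument
    (h_exog : ∀ G a, RandSat.indivExp (P G)
      (fun s i => RandSat.rho (P G) s * (RandSat.trueInstr (R G) s i a * (s.2 i).U)) = 0)
    (h_relev : ∀ G a b, RandSat.indivExp (P G)
      (fun s i => RandSat.rho (P G) s * (RandSat.trueInstr (R G) s i a * (s.2 i).X b)) =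
        (1 : Matrix (Fin k) (Fin k) ℝ) a b)
    -- second moments
    (h_momX : RandSat.IsLittle (fun G => RandSat.indivExpNonneg (P G) fun s i =>
      RandSat.rho (P G) s ^ 2 * ‖vecMulVec (RandSat.trueInstr (R G) s i) (s.2 i).X‖ ^ 2)
      (fun G => (G : ℝ)))
    (h_momU : RandSat.IsLittle (fun G => RandSat.indivExpNonneg (P G) fun s i =>
      RandSat.rho (P G) s ^ 2 * RandSat.vnorm ((s.2 i).U • RandSat.trueInstr (R G) s i) ^ 2)
      (fun G => (G : ℝ)))
    -- estimation error of the instrument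
    (h_errX : RandSat.IsLittleP μ (fun G ω => ‖∑ g, RandSat.groupMean (S G g ω) fun i =>
      RandSat.rho (P G) (S G g ω) • vecMulVec
        (RandSat.estInstr (R G) (S G g ω) i - RandSat.trueInstr (R G) (S G g ω) i)
        ((S G g ω).2 i).X‖) (fun G => (G : ℝ)))
    (h_errU : RandSat.IsLittleP μ (fun G ω => RandSat.vnorm
      (∑ g, RandSat.groupMean (S G g ω) fun i =>
        (RandSat.rho (P G) (S G g ω) * ((S G g ω).2 i).U) •
        (RandSat.estInstr (R G) (S G g ω) i - RandSat.trueInstr (R G) (S G g ω) i)))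
      (fun G => (G : ℝ)))
    -- variance convergence, Lyapunov condition, and the sharper rate for the estimation error
    (Sig : Matrix (Fin k) (Fin k) ℝ)
    (h_var : Tendsto (fun G => RandSat.covMatrix (P G) (RandSat.score (P G) (R G))) atTop (𝓝 Sig))
    (h_lyap : ∃ δ : ℝ, 0 < δ ∧ RandSat.IsLittle (fun G => RandSat.indivExpNonneg (P G) fun s i =>
      RandSat.rho (P G) s ^ (2 + δ) *
        RandSat.vnorm ((s.2 i).U • RandSat.trueInstr (R G) s i) ^ (2 + δ))
      (fun G => (G : ℝ) ^ (δ / 2)))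
    (h_errU' : RandSat.IsLittleP μ (fun G ω => RandSat.vnorm
      (∑ g, RandSat.groupMean (S G g ω) fun i =>
        (RandSat.rho (P G) (S G g ω) * ((S G g ω).2 i).U) •
        (RandSat.estInstr (R G) (S G g ω) i - RandSat.trueInstr (R G) (S G g ω) i)))
      (fun G => √(G : ℝ))) :
    TendstoInDistribution
      (fun (G : ℕ) ω => √(G : ℝ) • (RandSat.thetaHat (R G) (fun g => S G g ω) - ϑ)) atTop
      (id : EuclideanSpace ℝ (Fin k) → EuclideanSpace ℝ (Fin k)) μ
      (multivariateGaussian 0 Sig) := by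
  obtain ⟨δ, hδ, h_lyap⟩ := h_lyap
  have hchar := RandSat.tendsto_charFun_map_score h_law h_indep h_exog h_momU h_var hδ h_lyap
  have hA := RandSat.tendstoZeroInProb_relevance_sub_one h_law h_indep h_relev h_momX h_errX
  have hE : RandSat.TendstoZeroInProb μ (fun G ω => (√(G : ℝ))⁻¹ •
      (WithLp.toLp 2 (∑ g, RandSat.groupMean (S G g ω) fun i =>
        (RandSat.rho (P G) (S G g ω) * ((S G g ω).2 i).U) •
        (RandSat.estInstr (R G) (S G g ω) i - RandSat.trueInstr (R G) (S G g ω) i)) :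
        EuclideanSpace ℝ (Fin k))) := by
    refine (h_errU'.tendstoZeroInProb ?_).of_norm_le
      (Eventually.of_forall fun G => ae_of_all _ fun ω => ?_)
    · filter_upwards [eventually_gt_atTop 0] with G hG
      exact Real.sqrt_pos.2 (by exact_mod_cast hG)
    · rw [norm_smul, norm_mul, RandSat.vnorm, norm_norm]
  have hX : ∀ G : ℕ, AEMeasurable (fun ω => (√(G : ℝ))⁻¹ • ∑ g,
      (WithLp.toLp 2 (RandSat.score (P G) (R G) (S G g ω)) : EuclideanSpace ℝ (Fin k))) (μ G) :=
    fun G => AEMeasurable.fun_const_smul (Finset.aemeasurable_fun_sum _ fun g _ =>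
      ((WithLp.measurable_toLp 2 (Fin k → ℝ)).comp
        (RandSat.measurable_score (P G) (R G))).comp_aemeasurable
        (h_law G g).aemeasurable) _
  have hθ : ∀ G : ℕ, AEMeasurable
      (fun ω => √(G : ℝ) • (RandSat.thetaHat (R G) (fun g => S G g ω) - ϑ)) (μ G) := fun G =>
    AEMeasurable.fun_const_smul (((RandSat.measurable_thetaHat (R G) G).comp_aemeasurable
      (aemeasurable_pi_lambda _ fun g => (h_law G g).aemeasurable)).sub_const ϑ) _
  refine RandSat.tendstoInDistribution_inv_mulVec hX hθ hchar hA hE ?_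
  filter_upwards [eventually_gt_atTop 0] with G hG
  have hmod : ∀ᵐ ω ∂(μ G), ∀ g i, ((S G g ω).2 i).Y =
      ((S G g ω).2 i).X ⬝ᵥ ϑ.ofLp + ((S G g ω).2 i).U := by
    -- The model holds almost surely in the population, hence for each sampled group, whose law is
    -- `P G`.
    refine ae_all_iff.2 fun g => ?_
    have := h_model G
    rw [← (h_law G g).map_eq] at this
    exact ae_of_ae_map (h_law G g).aemeasurable this
  -- Integrability of the group size matters: otherwise the integral would be 0 by convention and
  -- `rho` would degenerate.
  have hEN : 0 < ∫ s : RandSat.Group k, (s.1 : ℝ) ∂(P G) := by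
    have h2 : ∫ _ : RandSat.Group k, (2 : ℝ) ∂(P G) ≤ ∫ s : RandSat.Group k, (s.1 : ℝ) ∂(P G) :=
      integral_mono_ae (integrable_const _) (hN G)
        ((hN2 G).mono fun s hs => by simpa using (by exact_mod_cast hs : (2 : ℝ) ≤ s.1))
    simp at h2
    linarith
  filter_upwards [hmod] with ω hω hdet
  rw [RandSat.sqrt_smul_thetaHat_sub hEN (R G) ϑ hG _ hω rfl hdet, RandSat.smul_sum_score_add]
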